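/- Let $\delta\ge 0$, and let $\Gamma$ be a $\delta$-hyperbolic graph: a connected graph with edges of length one, regarded as a geodesic metric space with its path metric, in which each side of every geodesic triangle is contained in the $\delta$-neighbourhood of the union of the two other sides. Let a group $G$ act on $\Gamma$ by isometries, acylindrically with constants $K(R),L(R)\ge 1$ $(R\ge 0)$: for every $R\ge 0$ and all vertices $x,y$ with $d(x,y)\ge L(R)$, the set $\{h\in G: d(x,hx)\le R,\ d(y,hy)\le R\}$ has at most $K(R)$ elements. For $h\in G$ let $\mathrm{tr}(h)=\lim_{n\to\infty} d(x,h^n x)/n$, which does not depend on $x\in\Gamma$. Call $h$ hyperbolic if there are $x\in\Gamma$ and $C>0$ with $d(x,h^n x)\ge Cn$ for all $n>0$, and call a bi-infinite geodesic $\alpha$ a quasi-axis of $h$ if $h(\alpha)$ lies in the $C$-neighbourhood of $\alpha$ for some $C\ge 0$. There is an integer $N>0$, depending only on $\delta$, $K(20\delta)$, $L(20\delta)$ and $K(200\delta)$, with the following property. Let $f,g\in G$ be hyperbolic with quasi-axes $\alpha,\beta$ respectively, such that $[f^s,g^t]\ne 1$ for all integers $s,t\neq 0$. Suppose that 1. $\mathrm{tr}(g)\le\mathrm{tr}(f)$,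 and 2. the diameter of the $10\delta$-overlap $(\alpha\cap N_{10\delta}(\beta))\cup(\beta\cap N_{10\delta}(\alpha))$ is at most $2\,\mathrm{tr}(f)$, where $N_{10\delta}$ denotes the closed $10\delta$-neighbourhood. Then, for every integer $n\ge N$, the subgroup $\langle g,f^n\rangle$ of $G$ is free of rank two, and for every $x\in\Gamma$ the orbit map $w\mapsto w(x)$ from $\langle g,f^n\rangle$, with the word metric of $\{g,f^n\}$, to $\Gamma$ is a quasi-isometric embedding. -/

import Mathlib

open Filter Topology

universe u v

/-! ### Metric graphs -/

/-- `EdgeChain c x y r`: there is a finite chain of points from `x` to `y`, consecutive ones lying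
on a common edge, of total length `r`. Here `c e : [0,1] → Γ` is the characteristic map of the
edge `e`, and every edge has length one. -/
inductive EdgeChain {Γ E : Type u} (c : E → unitInterval → Γ) : Γ → Γ → ℝ → Prop
  | nil (x : Γ) : EdgeChain c x x 0
  | cons (e : E) (s t : unitInterval) {y : Γ} {r : ℝ} (h : EdgeChain c (c e t) y r) :
      EdgeChain c (c e s) y (|(s : ℝ) - t| + r)

/-- The structure of a connected graph with edges of length one on the metric space `Γ`: as a set,
`Γ` is the disjoint union of the vertices and of the open edges, and the distance is the path
metric, the infimum of the lengths of edge chains. (The infimum is over a non-empty set, since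
`∅ : Set ℝ` has no greatest lower bound; so `Γ` is connected.) Loops and multiple edges are allowed,
and no local finiteness is assumed. -/
structure MetricGraph (Γ : Type u) [MetricSpace Γ] where
  /-- the set of vertices -/
  vertices : Set Γ
  /-- the type of (arbitrarily oriented) edges -/
  Edge : Type u
  /-- the characteristic map of an edge -/
  char : Edge → unitInterval → Γ
  char_zero_mem : ∀ e, char e 0 ∈ vertices
  char_one_mem : ∀ e, char e 1 ∈ vertices
  char_notMem : ∀ e t, 0 < t → t < 1 → char e t ∉ vertices
  existsUnique_char : ∀ x, x ∉ vertices →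
    ∃! p : Edge × unitInterval, 0 < p.2 ∧ p.2 < 1 ∧ char p.1 p.2 = x
  isGLB_dist : ∀ x y, IsGLB {r : ℝ | EdgeChain char x y r} (dist x y)

/-! ### Geodesics and hyperbolicity -/

section Metric

variable {Γ : Type u} [MetricSpace Γ]

/-- `γ` restricted to `[0, dist x y]` is a geodesic from `x` to `y`. -/
structure IsGeodesicSegment (γ : ℝ → Γ) (x y : Γ) : Prop where
  map_zero : γ 0 = x
  map_dist : γ (dist x y) = y
  dist_eq : ∀ s ∈ Set.Icc 0 (dist x y), ∀ t ∈ Set.Icc 0 (dist x y), dist (γ s) (γ t) = |s - t|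

/-- The (closed) `r`-neighbourhood of a set. -/
def nbhd (r : ℝ) (S : Set Γ) : Set Γ := {x | ∃ y ∈ S, dist x y ≤ r}

/-- The `r`-overlap `(S ∩ N_r(T)) ∪ (T ∩ N_r(S))` of two sets. -/
def overlap (r : ℝ) (S T : Set Γ) : Set Γ := (S ∩ nbhd r T) ∪ (T ∩ nbhd r S)

variable (Γ) in
/-- A geodesic space in which each side of every geodesic triangle lies in the `δ`-neighbourhood
of the union of the two other sides. -/
structure IsDeltaHyperbolic (δ : ℝ) : Prop where
  geodesic : ∀ x y : Γ, ∃ γ : ℝ → Γ, IsGeodesicSegment γ x y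
  thin : ∀ (x y z : Γ) (γ₁ γ₂ γ₃ : ℝ → Γ), IsGeodesicSegment γ₁ x y → IsGeodesicSegment γ₂ y z →
    IsGeodesicSegment γ₃ z x →
    γ₁ '' Set.Icc 0 (dist x y) ⊆
      nbhd δ (γ₂ '' Set.Icc 0 (dist y z) ∪ γ₃ '' Set.Icc 0 (dist z x))

end Metric

/-! ### Isometric actions -/

section Action

variable {Γ : Type u} [MetricSpace Γ] {G : Type v} [Group G] [MulAction G Γ]

/-- The action is acylindrical with constants `K R`, `L R`. -/
def IsAcylindrical (X : MetricGraph Γ) (G : Type v) [Group G] [MulAction G Γ] (K L : ℝ → ℝ) :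
    Prop :=
  ∀ R : ℝ, 0 ≤ R → 1 ≤ K R ∧ 1 ≤ L R ∧
    ∀ x ∈ X.vertices, ∀ y ∈ X.vertices, L R ≤ dist x y →
      {g : G | dist x (g • x) ≤ R ∧ dist y (g • y) ≤ R}.Finite ∧
      ({g : G | dist x (g • x) ≤ R ∧ dist y (g • y) ≤ R}.ncard : ℝ) ≤ K R

variable (Γ) in
/-- `a` acts on `Γ` as a hyperbolic isometry. -/
def IsHyperbolicIsometry (a : G) : Prop :=
  ∃ (x : Γ) (C : ℝ), 0 < C ∧ ∀ n : ℕ, 0 < n → C * n ≤ dist x (a ^ n • x)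

/-- The bi-infinite geodesic `α` is a quasi-axis of `a`: `a(α)` lies in a bounded neighbourhood
of `α`. -/
def IsQuasiAxis (a : G) (α : ℝ → Γ) : Prop :=
  Isometry α ∧ ∃ C : ℝ, 0 ≤ C ∧ ∀ t : ℝ, a • α t ∈ nbhd C (Set.range α)

variable (Γ) in
/-- The translation length `lim dist x (aⁿ x) / n`, computed at some point `x`; it does not depend
on the point, and the limit exists (`tendsto_translationLength`). -/
noncomputable def translationLength [Nonempty Γ] (a : G) : ℝ :=
  limUnder atTop fun n : ℕ =>
    dist (Classical.arbitrary Γ) (a ^ n • Classical.arbitrary Γ) / (n : ℝ)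

theorem tendsto_translationLength [IsIsometricSMul G Γ] [Nonempty Γ] (a : G) (x : Γ) :
    Tendsto (fun n : ℕ => dist x (a ^ n • x) / (n : ℝ)) atTop (𝓝 (translationLength Γ a)) := by
  have key : ∀ y : Γ, ∃ l, Tendsto (fun n : ℕ => dist y (a ^ n • y) / (n : ℝ)) atTop (𝓝 l) := by
    intro y
    have hs : Subadditive fun n : ℕ => dist y (a ^ n • y) := by
      intro m n
      calc dist y (a ^ (m + n) • y)
          ≤ dist y (a ^ m • y) + dist (a ^ m • y) (a ^ (m + n) • y) := dist_triangle _ _ _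
        _ = dist y (a ^ m • y) + dist y (a ^ n • y) := by
            rw [pow_add, mul_smul, dist_smul]
    refine ⟨_, hs.tendsto_lim ⟨0, ?_⟩⟩
    rintro _ ⟨n, rfl⟩
    positivity
  obtain ⟨l, hl⟩ := key x
  set z : Γ := Classical.arbitrary Γ with hz
  obtain ⟨m, hm⟩ := key z
  have h0 : Tendsto (fun n : ℕ => (2 * dist x z) / (n : ℝ)) atTop (𝓝 0) :=
    tendsto_const_div_atTop_nhds_zero_nat _
  have hd : ∀ n : ℕ, |dist x (a ^ n • x) / (n : ℝ) - dist z (a ^ n • z) / (n : ℝ)|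
      ≤ (2 * dist x z) / (n : ℝ) := by
    intro n
    rw [← sub_div, abs_div, Nat.abs_cast]
    gcongr
    have := dist_dist_dist_le x (a ^ n • x) z (a ^ n • z)
    rw [dist_smul, Real.dist_eq] at this
    linarith
  have h1 : Tendsto (fun n : ℕ => dist x (a ^ n • x) / (n : ℝ) - dist z (a ^ n • z) / (n : ℝ))
      atTop (𝓝 0) := squeeze_zero_norm hd h0
  have h2 : l - m = 0 := tendsto_nhds_unique (hl.sub hm) h1
  have h3 : translationLength Γ a = m := hm.limUnder_eq
  rw [h3, ← sub_eq_zero.mp h2]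
  exact hl

/-- The word length of `g` with respect to `S`: the least length of a word in the elements of `S`
and their inverses that represents `g` (used only for `g` in the subgroup generated by `S`). -/
noncomputable def wordLength (S : Set G) (g : G) : ℕ :=
  sInf {n : ℕ | ∃ l : List G, (∀ s ∈ l, s ∈ S ∨ s⁻¹ ∈ S) ∧ l.prod = g ∧ l.length = n}

/-- The orbit map `w ↦ w x` from the subgroup generated by `S`, with the word metric
`d(u, v) = |u⁻¹ v|`, to `Γ` is a quasi-isometric embedding. -/
def IsQuasiIsometricOrbit (S : Set G) (x : Γ) : Prop :=
  ∃ A B : ℝ, 1 ≤ A ∧ 0 ≤ B ∧ ∀ u ∈ Subgroup.closure S, ∀ v ∈ Subgroup.closure S,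
    (wordLength S (u⁻¹ * v) : ℝ) / A - B ≤ dist (u • x) (v • x) ∧
      dist (u • x) (v • x) ≤ A * wordLength S (u⁻¹ * v) + B

end Action

/-! ### Thin triangles, the four-point inequality, and coarse projections to lines. -/

section Geometry

variable {Γ : Type u} [MetricSpace Γ] {δ : ℝ}

/-! Up to an error of `72 * δ`, `f` translates its suitably oriented axis `α` by `T = tr(f)`
(`exists_translation_axis`). Everything is measured by coarse nearest-point projection to `α`.

Two families of projections are bounded. The projection of `β` has diameter at most `D₁ = 2T + 20δ`,
since a larger one would force a long overlap (`abs_sub_le_of_overlap`). For `a ≠ 0` the projection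
of the line `g ^ a • α` has diameter at most `D₂ = mT + L + 360δ + 5`, with `L = L (20 * δ)` and `m`
the integer part of `333 ^ 2 * K (20 * δ)`. Otherwise the two lines fellow-travel for so long that,
by acylindricity and pigeonhole, `g ^ a` conjugates a nontrivial power `f ^ r` to `f ^ (±r)`. Then
`g ^ (2a)` commutes with `f ^ r`, which is excluded.

Choose a base point `p` on `α` almost nearest to `β`. All `g ^ a • p` then project near `p`, while
`f ^ (n * b)` shifts projections by `n |b| T`. For large `n` the broken orbit path of a reduced word
in `g` and `f ^ n` has long edges and small Gromov products at its corners. The four-point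
inequality makes such a path efficient (`le_dist_syllableWord`), so displacement is at least linear
in the exponents. Freeness and the quasi-isometric embedding both follow.

For `N` to be uniform, the additive constants must be multiples of `T`. If `δ > 0`, acylindricity
gives `δ ≤ mT`, because otherwise too many powers of `f` move points of `α` little. If `δ = 0`, the
space is a tree with a point off `α`. A branch point on `α` is a vertex, and so is its translate,
whence `T ≥ 1`. -/

theorem IsGeodesicSegment.symm {γ : ℝ → Γ} {x y : Γ} (h : IsGeodesicSegment γ x y) :
    IsGeodesicSegment (fun t => γ (dist x y - t)) y x := by
  refine ⟨by simpa using h.map_dist, by simpa [dist_comm y x] using h.map_zero, ?_⟩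
  intro s hs t ht
  rw [dist_comm y x] at hs ht
  rw [h.dist_eq _ ⟨by linarith [hs.2], by linarith [hs.1]⟩ _
    ⟨by linarith [ht.2], by linarith [ht.1]⟩,
    abs_sub_comm]
  congr 1
  ring

theorem IsGeodesicSegment.dist_add {γ : ℝ → Γ} {x y : Γ} (h : IsGeodesicSegment γ x y) {t : ℝ}
    (ht : t ∈ Set.Icc 0 (dist x y)) : dist x (γ t) + dist (γ t) y = dist x y := by
  have h1 := h.dist_eq 0 ⟨le_rfl, dist_nonneg⟩ t ht
  have h2 := h.dist_eq t ht (dist x y) ⟨dist_nonneg, le_rfl⟩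
  rw [h.map_zero] at h1
  rw [h.map_dist] at h2
  rw [h1, h2, abs_of_nonpos (by linarith [ht.1]), abs_of_nonpos (by linarith [ht.2])]
  ring

theorem IsGeodesicSegment.continuousOn {γ : ℝ → Γ} {x y : Γ} (h : IsGeodesicSegment γ x y) :
    ContinuousOn γ (Set.Icc 0 (dist x y)) := by
  have : LipschitzOnWith 1 γ (Set.Icc 0 (dist x y)) :=
    LipschitzOnWith.of_dist_le_mul fun s hs t ht => by
      rw [h.dist_eq s hs t ht, NNReal.coe_one, one_mul, Real.dist_eq]
  exact this.continuousOn

theorem Isometry.dist_real {α : ℝ → Γ} (hα : Isometry α) (s t : ℝ) :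
    dist (α s) (α t) = |s - t| := by
  rw [hα.dist_eq, Real.dist_eq]

theorem Isometry.exists_isGeodesicSegment {α : ℝ → Γ} (hα : Isometry α) (s t : ℝ) :
    ∃ γ : ℝ → Γ, IsGeodesicSegment γ (α s) (α t) ∧ (∀ r, γ r ∈ Set.range α) ∧
      ∀ r ∈ Set.uIcc s t, α r ∈ γ '' Set.Icc 0 (dist (α s) (α t)) := by
  rcases le_total s t with hst | hst
  · refine ⟨fun r => α (s + r), ⟨by simp, ?_, ?_⟩, fun r => ⟨_, rfl⟩, ?_⟩
    · rw [hα.dist_real, abs_of_nonpos (by linarith)]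
      congr 1
      ring
    · intro a _ b _
      rw [hα.dist_real]
      congr 1
      ring
    · intro r hr
      rw [Set.uIcc_of_le hst] at hr
      refine ⟨r - s, ⟨by linarith [hr.1], ?_⟩, by simp⟩
      rw [hα.dist_real, abs_of_nonpos (by linarith)]
      linarith [hr.2]
  · refine ⟨fun r => α (s - r), ⟨by simp, ?_, ?_⟩, fun r => ⟨_, rfl⟩, ?_⟩
    · rw [hα.dist_real, abs_of_nonneg (by linarith)]
      congr 1
      ring
    · intro a _ b _
      rw [hα.dist_real, abs_sub_comm]
      congr 1
      ring
    · intro r hr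
      rw [Set.uIcc_of_ge hst] at hr
      refine ⟨s - r, ⟨by linarith [hr.2], ?_⟩, by simp⟩
      rw [hα.dist_real, abs_of_nonneg (by linarith)]
      linarith [hr.1]

/-- A side of a geodesic triangle contains a point that is `δ`-close to both other sides. -/
theorem IsDeltaHyperbolic.exists_center (h : IsDeltaHyperbolic Γ δ) {γ : ℝ → Γ} {x z : Γ}
    (hγ : IsGeodesicSegment γ x z) (w : Γ) :
    ∃ t ∈ Set.Icc 0 (dist x z), ∃ q r : Γ, dist (γ t) q ≤ δ ∧ dist (γ t) r ≤ δ ∧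
      dist z q + dist q w = dist z w ∧ dist w r + dist r x = dist w x := by
  obtain ⟨γ₂, h₂⟩ := h.geodesic z w
  obtain ⟨γ₃, h₃⟩ := h.geodesic w x
  have hthin := h.thin x z w γ γ₂ γ₃ hγ h₂ h₃
  have hc₂ : IsCompact (γ₂ '' Set.Icc 0 (dist z w)) :=
    isCompact_Icc.image_of_continuousOn h₂.continuousOn
  have hc₃ : IsCompact (γ₃ '' Set.Icc 0 (dist w x)) :=
    isCompact_Icc.image_of_continuousOn h₃.continuousOn
  have hz₂ : z ∈ γ₂ '' Set.Icc 0 (dist z w) := ⟨0, ⟨le_rfl, dist_nonneg⟩, h₂.map_zero⟩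
  have hx₃ : x ∈ γ₃ '' Set.Icc 0 (dist w x) := ⟨_, ⟨dist_nonneg, le_rfl⟩, h₃.map_dist⟩
  set S₂ := γ₂ '' Set.Icc 0 (dist z w)
  set S₃ := γ₃ '' Set.Icc 0 (dist w x)
  have hδ : 0 ≤ δ := by
    obtain ⟨y, _, hy⟩ := hthin ⟨0, ⟨le_rfl, dist_nonneg⟩, rfl⟩
    exact dist_nonneg.trans hy
  have hcl : ∀ S : Set Γ, IsClosed {p : Γ | Metric.infDist p S ≤ δ} := fun S =>
    isClosed_le (Metric.continuous_infDist_pt S) continuous_const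
  have hpre : IsPreconnected (γ '' Set.Icc 0 (dist x z)) :=
    isPreconnected_Icc.image _ hγ.continuousOn
  have hcover : γ '' Set.Icc 0 (dist x z) ⊆
      {p : Γ | Metric.infDist p S₂ ≤ δ} ∪ {p : Γ | Metric.infDist p S₃ ≤ δ} := by
    intro p hp
    obtain ⟨y, hy | hy, hpy⟩ := hthin hp
    · exact Or.inl ((Metric.infDist_le_dist_of_mem hy).trans hpy)
    · exact Or.inr ((Metric.infDist_le_dist_of_mem hy).trans hpy)
  -- The closed `δ`-neighbourhoods of the other two sides cover this connected side, and each
  -- contains one of its ends. Hence they meet on it.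
  obtain ⟨p, ⟨t, ht, rfl⟩, hp₂, hp₃⟩ := isPreconnected_closed_iff.mp hpre _ _ (hcl S₂)
    (hcl S₃) hcover
    ⟨z, ⟨_, ⟨dist_nonneg, le_rfl⟩, hγ.map_dist⟩, by
      simpa [Metric.infDist_zero_of_mem hz₂] using hδ⟩
    ⟨x, ⟨0, ⟨le_rfl, dist_nonneg⟩, hγ.map_zero⟩, by
      simpa [Metric.infDist_zero_of_mem hx₃] using hδ⟩
  obtain ⟨q, ⟨a, ha, rfl⟩, hq⟩ := hc₂.exists_infDist_eq_dist ⟨z, hz₂⟩ (γ t)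
  obtain ⟨r, ⟨b, hb, rfl⟩, hr⟩ := hc₃.exists_infDist_eq_dist ⟨x, hx₃⟩ (γ t)
  exact ⟨t, ht, _, _, hq ▸ hp₂, hr ▸ hp₃, h₂.dist_add ha, h₃.dist_add hb⟩

/-- The four-point inequality. -/
theorem IsDeltaHyperbolic.four_point (h : IsDeltaHyperbolic Γ δ) (x y z w : Γ) :
    dist x z + dist y w ≤ max (dist x y + dist z w) (dist x w + dist y z) + 4 * δ := by
  obtain ⟨γ, hγ⟩ := h.geodesic x z
  obtain ⟨t, ht, q, r, hq, hr, hq', hr'⟩ := h.exists_center hγ w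
  obtain ⟨γ₂, h₂⟩ := h.geodesic z y
  obtain ⟨γ₃, h₃⟩ := h.geodesic y x
  have hp := hγ.dist_add ht
  -- The centre `p` is close to both `[z, w]` and `[w, x]`. The side of the triangle `x z y` that
  -- `p` is also close to decides which of the two sums bounds the left side.
  obtain ⟨o, ho, hpo⟩ := h.thin x z y γ γ₂ γ₃ hγ h₂ h₃ ⟨t, ht, rfl⟩
  set p := γ t
  have e1 := dist_triangle y p w
  have e2 := dist_triangle x r p
  have e3 := dist_triangle w r p
  have e4 := dist_triangle z q p
  have e5 := dist_triangle w q p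
  simp only [dist_comm] at *
  rcases ho with ⟨a, ha, rfl⟩ | ⟨a, ha, rfl⟩
  · have := h₂.dist_add (by simpa [dist_comm] using ha)
    have e6 := dist_triangle z (γ₂ a) p
    have e7 := dist_triangle y (γ₂ a) p
    have := le_max_right (dist x y + dist z w) (dist x w + dist y z)
    simp only [dist_comm] at *
    linarith
  · have := h₃.dist_add (by simpa [dist_comm] using ha)
    have e6 := dist_triangle x (γ₃ a) p
    have e7 := dist_triangle y (γ₃ a) p
    have := le_max_left (dist x y + dist z w) (dist x w + dist y z)
    simp only [dist_comm] at *
    linarith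

theorem IsDeltaHyperbolic.nonneg [Nonempty Γ] (h : IsDeltaHyperbolic Γ δ) : 0 ≤ δ := by
  have := h.four_point (Classical.arbitrary Γ) (Classical.arbitrary Γ) (Classical.arbitrary Γ)
    (Classical.arbitrary Γ)
  simp at this
  linarith

/-- A geodesic quadrilateral two of whose sides lie on lines is `2δ`-thin. -/
theorem IsDeltaHyperbolic.quadrilateral (h : IsDeltaHyperbolic Γ δ) {α γ : ℝ → Γ}
    (hα : Isometry α) (hγ : Isometry γ) {t₁ t₂ u : ℝ} (hu : u ∈ Set.Icc t₁ t₂) (s₁ s₂ : ℝ) :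
    ∃ q : Γ, dist (α u) q ≤ 2 * δ ∧ (q ∈ Set.range γ ∨
      dist (α t₁) q + dist q (γ s₁) = dist (α t₁) (γ s₁) ∨
      dist (α t₂) q + dist q (γ s₂) = dist (α t₂) (γ s₂)) := by
  obtain ⟨a, ha, -, ha'⟩ := hα.exists_isGeodesicSegment t₁ t₂
  obtain ⟨σ, hσ⟩ := h.geodesic (α t₂) (γ s₁)
  obtain ⟨b, hb⟩ := h.geodesic (γ s₁) (α t₁)
  obtain ⟨q, hq, huq⟩ := h.thin _ _ _ _ _ _ ha hσ hb
    (ha' u (by rwa [Set.uIcc_of_le (hu.1.trans hu.2)]))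
  have hδ : 0 ≤ δ := dist_nonneg.trans huq
  rcases hq with hq | ⟨r, hr, rfl⟩
  · obtain ⟨c, hc, hc', -⟩ := hγ.exists_isGeodesicSegment s₁ s₂
    obtain ⟨d, hd⟩ := h.geodesic (γ s₂) (α t₂)
    obtain ⟨o, ho, hqo⟩ := h.thin _ _ _ _ _ _ hσ hc hd hq
    refine ⟨o, (dist_triangle _ q _).trans (by linarith), ?_⟩
    rcases ho with ⟨r, -, rfl⟩ | ⟨r, hr, rfl⟩
    · exact Or.inl (hc' r)
    · have := hd.dist_add hr
      right; right
      simp only [dist_comm] at *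
      linarith
  · have := hb.dist_add hr
    refine ⟨_, huq.trans (by linarith), ?_⟩
    right; left
    simp only [dist_comm] at *
    linarith

/-- `α t` is, up to an error `c`, the nearest-point projection of `x` to the line `α`. -/
def IsProj (α : ℝ → Γ) (c : ℝ) (x : Γ) (t : ℝ) : Prop :=
  ∀ s, dist x (α t) + |s - t| ≤ dist x (α s) + c

/-- A nearest point works. For `s` far from `t`, apply the four-point inequality with a point `u` at
distance `4 * δ + ε` from `t` towards `s`. One alternative would make `α u` nearer to `x` than `α
t`; the other is the claim up to `ε`. -/
theorem IsDeltaHyperbolic.exists_isProj (h : IsDeltaHyperbolic Γ δ) {α : ℝ → Γ} (hα : Isometry α)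
    (x : Γ) : ∃ t, IsProj α (8 * δ) x t ∧ ∀ s, dist x (α t) ≤ dist x (α s) := by
  have : Nonempty Γ := ⟨x⟩
  have hδ := h.nonneg
  have htend : Tendsto (fun t => dist x (α t)) (cocompact ℝ) atTop := by
    refine tendsto_atTop_mono (f := fun t : ℝ => ‖t‖ - dist x (α 0)) (fun t => ?_) ?_
    · have h1 := dist_triangle (α t) x (α 0)
      rw [hα.dist_real, sub_zero, dist_comm (α t) x] at h1
      rw [Real.norm_eq_abs]
      linarith
    · simpa [sub_eq_add_neg] using
        tendsto_atTop_add_const_right _ (-dist x (α 0)) (tendsto_norm_cocompact_atTop (E := ℝ))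
  obtain ⟨t, ht⟩ := (continuous_const.dist hα.continuous).exists_forall_le htend
  refine ⟨t, fun s => ?_, ht⟩
  refine le_of_forall_pos_le_add fun ε hε => ?_
  rcases le_or_gt |s - t| (4 * δ + ε) with hs | hs
  · linarith [ht s]
  · obtain ⟨u, hu1, hu2⟩ : ∃ u, |u - t| = 4 * δ + ε ∧ |s - u| = |s - t| - (4 * δ + ε) := by
      rcases le_total t s with hts | hts
      · rw [abs_of_nonneg (by linarith)] at hs ⊢
        exact ⟨t + (4 * δ + ε), by rw [abs_of_nonneg] <;> linarith,
          by rw [abs_of_nonneg] <;> linarith⟩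
      · rw [abs_of_nonpos (by linarith)] at hs ⊢
        exact ⟨t - (4 * δ + ε), by rw [abs_of_nonpos] <;> linarith,
          by rw [abs_of_nonpos] <;> linarith⟩
    have h4 := h.four_point x (α t) (α u) (α s)
    have e1 := hα.dist_real u s
    have e2 := hα.dist_real t s
    have e3 := hα.dist_real t u
    rw [abs_sub_comm] at e1 e2 e3
    rw [e1, e2, e3] at h4
    have := ht u
    rcases max_cases (dist x (α t) + |s - u|) (dist x (α s) + |u - t|) with ⟨h5, -⟩ | ⟨h5, -⟩ <;>
      rw [h5] at h4 <;> linarith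

/-- Four-point inequality for two points and their projections: either the path through the
projections is nearly geodesic, or the projections are close together. -/
theorem IsDeltaHyperbolic.dist_of_isProj (h : IsDeltaHyperbolic Γ δ) {α : ℝ → Γ}
    (hα : Isometry α) {c c' : ℝ} {x y : Γ} {t s : ℝ} (hx : IsProj α c x t) (hy : IsProj α c' y s) :
    dist x (α t) + |t - s| + dist y (α s) ≤ dist x y + (c + c' + 4 * δ) ∨
      2 * |t - s| ≤ c + c' + 4 * δ := by
  have h4 := h.four_point x y (α s) (α t)
  have h1 := hx s
  have h2 := hy t
  have e := hα.dist_real s t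
  rw [e] at h4
  rw [abs_sub_comm s t] at *
  rcases max_cases (dist x y + |t - s|) (dist x (α t) + dist y (α s)) with ⟨h5, -⟩ | ⟨h5, -⟩ <;>
      rw [h5] at h4
  · left; linarith
  · right; linarith

/-- In the quadrilateral spanned by two points of `γ` and their projections, a point of `α` well
between the projections cannot be near the two perpendicular sides, so it is near `γ`. -/
theorem IsDeltaHyperbolic.exists_near_of_isProj (h : IsDeltaHyperbolic Γ δ) {α γ : ℝ → Γ}
    (hα : Isometry α) (hγ : Isometry γ) {c : ℝ} {s₁ s₂ t₁ t₂ u : ℝ} (hc : 0 ≤ c)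
    (h₁ : IsProj α c (γ s₁) t₁) (h₂ : IsProj α c (γ s₂) t₂) (hu₁ : t₁ + (c + 2 * δ) < u)
    (hu₂ : u < t₂ - (c + 2 * δ)) : ∃ s, dist (α u) (γ s) ≤ 2 * δ := by
  have : Nonempty Γ := ⟨α 0⟩
  have hδ := h.nonneg
  obtain ⟨q, hq, ⟨s, rfl⟩ | hq' | hq'⟩ :=
    h.quadrilateral hα hγ (u := u) (t₁ := t₁) (t₂ := t₂) ⟨by linarith, by linarith⟩ s₁ s₂
  · exact ⟨s, hq⟩
  · have e1 := h₁ u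
    have e2 := dist_triangle (γ s₁) q (α u)
    have e3 := dist_nonneg (x := α t₁) (y := q)
    have e4 := le_abs_self (u - t₁)
    simp only [dist_comm] at *
    linarith
  · have e1 := h₂ u
    have e2 := dist_triangle (γ s₂) q (α u)
    have e3 := dist_nonneg (x := α t₂) (y := q)
    have e4 := neg_le_abs (u - t₂)
    simp only [dist_comm] at *
    linarith

/-- Points at the same position on two geodesics with nearby endpoints are close. -/
theorem IsDeltaHyperbolic.fellow_travel (h : IsDeltaHyperbolic Γ δ) {ρ u l l' : ℝ}
    {x y z x' y' z' : Γ} (h1 : dist x y = u) (h2 : dist y z = l - u) (h3 : dist x z = l)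
    (h1' : dist x' y' = u) (h2' : dist y' z' = l' - u) (h3' : dist x' z' = l')
    (hx : dist x x' ≤ ρ) (hz : dist z z' ≤ ρ) : dist y y' ≤ 3 * ρ + 4 * δ := by
  have h4 := h.four_point y x' y' z'
  have e1 := dist_triangle y x x'
  have e2 := dist_triangle y z z'
  have e3 := dist_triangle4 x x' z' z
  have e4 := max_le (a := dist y x' + dist y' z') (b := dist y z' + dist x' y') (c := l' + 3 * ρ)
  rw [dist_comm y x] at e1
  rw [dist_comm z' z] at e3
  have := dist_nonneg.trans hx
  have := e4 (by linarith) (by linarith)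
  linarith

end Geometry

/-! ### Translation lengths bound displacements from below. -/

section Translation

variable {Γ : Type u} [MetricSpace Γ] {G : Type v} [Group G] [MulAction G Γ] [IsIsometricSMul G Γ]

theorem dist_pow_smul_le (a : G) (x : Γ) (n : ℕ) : dist x (a ^ n • x) ≤ n * dist x (a • x) := by
  induction n with
  | zero => simp
  | succ n ih =>
    have h := dist_triangle x (a ^ n • x) (a ^ (n + 1) • x)
    rw [pow_succ, mul_smul, dist_smul] at h
    rw [pow_succ, mul_smul]
    push_cast
    linarith

variable [Nonempty Γ]

theorem translationLength_le_dist (a : G) (x : Γ) (n : ℕ) :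
    n * translationLength Γ a ≤ dist x (a ^ n • x) := by
  rcases Nat.eq_zero_or_pos n with rfl | hn
  · simp
  have hn' : (0 : ℝ) < n := by exact_mod_cast hn
  -- The limit is taken along multiples of `n`, where displacement grows at most linearly in the
  -- multiplier.
  have h1 := (tendsto_translationLength a x).comp
    (tendsto_id.const_mul_atTop' hn : Tendsto (fun m : ℕ => n * m) atTop atTop)
  have h2 : translationLength Γ a ≤ dist x (a ^ n • x) / n := by
    refine le_of_tendsto h1 (eventually_atTop.mpr ⟨1, fun m hm => ?_⟩)
    have hm' : (0 : ℝ) < m := by exact_mod_cast hm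
    have h3 := dist_pow_smul_le (a ^ n) x m
    simp only [Function.comp, Nat.cast_mul, pow_mul]
    rw [div_le_div_iff₀ (by positivity) hn']
    nlinarith
  rwa [le_div_iff₀' hn'] at h2

theorem abs_mul_translationLength_le_dist (a : G) (x : Γ) (n : ℤ) :
    |(n : ℝ)| * translationLength Γ a ≤ dist x (a ^ n • x) := by
  obtain ⟨m, rfl | rfl⟩ := n.eq_nat_or_neg
  · simpa using translationLength_le_dist a x m
  · have h := translationLength_le_dist a x m
    rw [zpow_neg, zpow_natCast, dist_comm, ← dist_smul (a ^ m), smul_inv_smul]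
    simpa using h

theorem IsHyperbolicIsometry.translationLength_pos {a : G} (h : IsHyperbolicIsometry Γ a) :
    0 < translationLength Γ a := by
  obtain ⟨x, C, hC, hx⟩ := h
  refine hC.trans_le (ge_of_tendsto (tendsto_translationLength a x)
    (eventually_atTop.mpr ⟨1, fun n hn => ?_⟩))
  rw [le_div_iff₀ (by exact_mod_cast hn)]
  exact hx n hn

end Translation

/-! ### Coarse isometries of the real line and quasi-additive sequences. -/

section CoarseLine

/-- A real number is determined by its distances to two distinct points. The points `0` and `2 * c +
1` are far enough apart for their images to be distinct, and the order of the images gives the sign.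
-/
theorem exists_sign_of_coarse_isometry {φ : ℝ → ℝ} {c : ℝ} (hc : 0 ≤ c)
    (h : ∀ s t, |(|φ s - φ t| - |s - t|)| ≤ c) :
    ∃ ε : ℝ, (ε = 1 ∨ ε = -1) ∧ ∀ t, |φ t - φ 0 - ε * t| ≤ 4 * c := by
  have key : ∀ t, (0 ≤ φ (2 * c + 1) - φ 0 → |φ t - φ 0 - t| ≤ 4 * c) ∧
      (φ (2 * c + 1) - φ 0 ≤ 0 → |φ t - φ 0 + t| ≤ 4 * c) := by
    intro t
    have h1 := abs_le.mp (h t 0)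
    have h2 := abs_le.mp (h (2 * c + 1) 0)
    have h3 := abs_le.mp (h t (2 * c + 1))
    obtain ⟨h1, h1'⟩ := h1
    obtain ⟨h2, h2'⟩ := h2
    obtain ⟨h3, h3'⟩ := h3
    have h4 : |2 * c + 1 - 0| = 2 * c + 1 := by rw [sub_zero, abs_of_nonneg (by linarith)]
    rw [h4] at h2 h2'
    rw [sub_zero] at h1 h1'
    constructor <;> intro h5
    · rw [abs_of_nonneg h5] at h2 h2'
      rcases abs_cases (φ t - φ 0) with ⟨e1, -⟩ | ⟨e1, -⟩ <;> rw [e1] at h1 h1' <;>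
      rcases abs_cases t with ⟨e2, -⟩ | ⟨e2, -⟩ <;> rw [e2] at h1 h1' <;>
      rcases abs_cases (φ t - φ (2 * c + 1)) with ⟨e3, -⟩ | ⟨e3, -⟩ <;> rw [e3] at h3 h3' <;>
      rcases abs_cases (t - (2 * c + 1)) with ⟨e4, -⟩ | ⟨e4, -⟩ <;> rw [e4] at h3 h3' <;>
      exact abs_le.mpr ⟨by linarith, by linarith⟩
    · rw [abs_of_nonpos h5] at h2 h2'
      rcases abs_cases (φ t - φ 0) with ⟨e1, -⟩ | ⟨e1, -⟩ <;> rw [e1] at h1 h1' <;>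
      rcases abs_cases t with ⟨e2, -⟩ | ⟨e2, -⟩ <;> rw [e2] at h1 h1' <;>
      rcases abs_cases (φ t - φ (2 * c + 1)) with ⟨e3, -⟩ | ⟨e3, -⟩ <;> rw [e3] at h3 h3' <;>
      rcases abs_cases (t - (2 * c + 1)) with ⟨e4, -⟩ | ⟨e4, -⟩ <;> rw [e4] at h3 h3' <;>
      exact abs_le.mpr ⟨by linarith, by linarith⟩
  rcases le_total 0 (φ (2 * c + 1) - φ 0) with h0 | h0
  · exact ⟨1, Or.inl rfl, fun t => by simpa using (key t).1 h0⟩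
  · exact ⟨-1, Or.inr rfl, fun t => by simpa using (key t).2 h0⟩

theorem eq_zero_of_forall_abs_add_mul_le {a b C : ℝ} (h : ∀ t : ℝ, |a + b * t| ≤ C) : b = 0 := by
  by_contra hb
  have h1 := h ((C + |a| + 1) / b)
  rw [mul_div_cancel₀ _ hb] at h1
  have := (abs_le.mp h1).2
  have := neg_abs_le a
  linarith

/-- A real quasi-additive sequence of linear growth rate `T` is uniformly close to `± n T`. -/
theorem exists_sign_of_quasiadditive {σ : ℕ → ℝ} {E T : ℝ}
    (h : ∀ i j, |σ (i + j) - (σ i + σ j)| ≤ E)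
    (hT : Tendsto (fun n : ℕ => |σ n| / n) atTop (𝓝 T)) :
    ∃ η : ℝ, (η = 1 ∨ η = -1) ∧ ∀ i : ℕ, |σ i - η * (i * T)| ≤ E := by
  have hmul : ∀ i m : ℕ, |σ (m * i) - m * σ i| ≤ (m + 1) * E := by
    intro i m
    induction m with
    | zero =>
      have := h 0 0
      simp only [zero_mul, Nat.cast_zero, zero_add, one_mul, sub_zero] at this ⊢
      rwa [show σ 0 - (σ 0 + σ 0) = -σ 0 by ring, abs_neg] at this
    | succ m ih =>
      have h1 := abs_le.mp (h (m * i) i)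
      have h2 := abs_le.mp ih
      rw [Nat.succ_mul]
      push_cast
      exact abs_le.mpr ⟨by linarith, by linarith⟩
  -- Both products approximate `σ (m * i)`. Dividing by `m` and letting `m` grow through indices
  -- where `σ m` has a constant sign gives the claim.
  have hcomp : ∀ i m : ℕ, |m * σ i - i * σ m| ≤ (m + i + 2) * E := by
    intro i m
    have h1 := abs_le.mp (hmul i m)
    have h2 := abs_le.mp (hmul m i)
    rw [mul_comm i m] at h2
    exact abs_le.mpr ⟨by linarith, by linarith⟩
  have hlim : ∀ i : ℕ, Tendsto (fun m : ℕ => (1 + (i + 2) / (m : ℝ)) * E + i * |(|σ m| / m - T)|)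
      atTop (𝓝 E) := by
    intro i
    have h1 : Tendsto (fun m : ℕ => ((i : ℝ) + 2) / (m : ℝ)) atTop (𝓝 0) :=
      tendsto_const_div_atTop_nhds_zero_nat _
    have h2 : Tendsto (fun m : ℕ => |(|σ m| / m - T)|) atTop (𝓝 0) := by
      simpa using (hT.sub_const T).abs
    simpa using ((h1.const_add 1).mul_const E).add (h2.const_mul (i : ℝ))
  obtain ⟨η, hη, hfreq⟩ : ∃ η : ℝ, (η = 1 ∨ η = -1) ∧ ∃ᶠ m in atTop, σ m = η * |σ m| := by
    by_cases hf : ∃ᶠ m in atTop, 0 ≤ σ m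
    · exact ⟨1, Or.inl rfl, hf.mono fun m hm => by rw [abs_of_nonneg hm, one_mul]⟩
    · refine ⟨-1, Or.inr rfl, Eventually.frequently ?_⟩
      filter_upwards [not_frequently.mp hf] with m hm
      rw [abs_of_neg (not_le.mp hm)]
      ring
  refine ⟨η, hη, fun i => le_of_forall_pos_le_add fun e he => ?_⟩
  obtain ⟨m, hm, hm', hm0⟩ := (hfreq.and_eventually
    (((hlim i).eventually_le_const (lt_add_of_pos_right E he)).and (eventually_gt_atTop 0))).exists
  refine le_trans ?_ hm'
  have hm0' : (0 : ℝ) < m := by exact_mod_cast hm0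
  have e1 : σ i - η * (i * T) = (m * σ i - i * σ m) / m + η * (i * (|σ m| / m - T)) := by
    rw [hm, abs_mul, abs_abs]
    have : |η| = 1 := by rcases hη with rfl | rfl <;> simp
    rw [this]
    field_simp
    ring
  rw [e1]
  refine (abs_add_le _ _).trans (add_le_add ?_ ?_)
  · rw [abs_div, Nat.abs_cast, div_le_iff₀ hm0']
    refine (hcomp i m).trans (le_of_eq ?_)
    field_simp
    ring
  · have : |η| = 1 := by rcases hη with rfl | rfl <;> simp
    rw [abs_mul, this, one_mul, abs_mul, Nat.abs_cast]

end CoarseLine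

/-! ### Hyperbolic isometries act on their quasi-axes as coarse translations. -/

section Axis

variable {Γ : Type u} [MetricSpace Γ] {δ : ℝ} {G : Type v} [Group G] [MulAction G Γ]
  [IsIsometricSMul G Γ]

theorem IsQuasiAxis.exists_pow_mem_nbhd {a : G} {α : ℝ → Γ} (h : IsQuasiAxis a α) (n : ℕ) :
    ∃ C : ℝ, ∀ t : ℝ, a ^ n • α t ∈ nbhd C (Set.range α) := by
  obtain ⟨-, C, -, hC⟩ := h
  induction n with
  | zero => exact ⟨0, fun t => ⟨α t, ⟨t, rfl⟩, by simp⟩⟩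
  | succ n ih =>
    obtain ⟨D, hD⟩ := ih
    refine ⟨D + C, fun t => ?_⟩
    obtain ⟨_, ⟨s, rfl⟩, hs⟩ := hD t
    obtain ⟨_, ⟨r, rfl⟩, hr⟩ := hC s
    refine ⟨_, ⟨r, rfl⟩, ?_⟩
    rw [pow_succ', mul_smul]
    refine (dist_triangle _ (a • α s) _).trans (add_le_add ?_ hr)
    rwa [dist_smul]

/-- A line in a bounded neighbourhood of a line `α` is within `2δ` of `α`. -/
theorem IsDeltaHyperbolic.exists_dist_le_of_nbhd (h : IsDeltaHyperbolic Γ δ) {α γ : ℝ → Γ}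
    (hα : Isometry α) (hγ : Isometry γ) {C : ℝ} (hC : ∀ t, γ t ∈ nbhd C (Set.range α)) (t : ℝ) :
    ∃ s, dist (γ t) (α s) ≤ 2 * δ := by
  have : Nonempty Γ := ⟨α 0⟩
  have hδ := h.nonneg
  have hC0 : 0 ≤ C := by
    obtain ⟨y, _, hy⟩ := hC 0
    exact dist_nonneg.trans hy
  -- At this distance from `γ t`, the short sides, of length at most `C`, stay out of reach of its
  -- `2 * δ`-ball.
  set M := C + 2 * δ + 1 with hM
  obtain ⟨_, ⟨s₁, rfl⟩, h₁⟩ := hC (t - M)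
  obtain ⟨_, ⟨s₂, rfl⟩, h₂⟩ := hC (t + M)
  obtain ⟨q, hq, ⟨s, rfl⟩ | hq' | hq'⟩ := h.quadrilateral hγ hα (u := t) (t₁ := t - M)
    (t₂ := t + M) ⟨by linarith, by linarith⟩ s₁ s₂
  · exact ⟨s, hq⟩
  · have e1 := dist_triangle (γ t) q (γ (t - M))
    have e2 := dist_nonneg (x := q) (y := α s₁)
    rw [hγ.dist_real, show t - (t - M) = M by ring, abs_of_pos (by linarith),
      dist_comm q] at e1
    linarith
  · have e1 := dist_triangle (γ t) q (γ (t + M))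
    have e2 := dist_nonneg (x := q) (y := α s₂)
    rw [hγ.dist_real, show t - (t + M) = -M by ring, abs_neg, abs_of_pos (by linarith),
      dist_comm q] at e1
    linarith

theorem isometry_smul_line (a : G) {α : ℝ → Γ} (hα : Isometry α) : Isometry fun t => a • α t :=
  (isometry_smul Γ a).comp hα

/-- An isometry acts on its quasi-axis, up to a bounded error, as an isometry of `ℝ`. -/
theorem IsDeltaHyperbolic.exists_shift (h : IsDeltaHyperbolic Γ δ) {a : G} {α : ℝ → Γ}
    (ha : IsQuasiAxis a α) (n : ℕ) :
    ∃ ε σ : ℝ, (ε = 1 ∨ ε = -1) ∧ ∀ t, dist (a ^ n • α t) (α (σ + ε * t)) ≤ 18 * δ := by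
  have hα := ha.1
  have : Nonempty Γ := ⟨α 0⟩
  have hδ := h.nonneg
  obtain ⟨C, hC⟩ := ha.exists_pow_mem_nbhd n
  choose φ hφ using h.exists_dist_le_of_nbhd hα (isometry_smul_line (a ^ n) hα) hC
  obtain ⟨ε, hε, hε'⟩ := exists_sign_of_coarse_isometry (φ := φ) (c := 4 * δ) (by linarith) (by
    intro s t
    rw [← hα.dist_real (φ s), ← hα.dist_real s, ← dist_smul (a ^ n) (α s)]
    refine abs_le.mpr ⟨?_, ?_⟩
    · have := dist_triangle4 (a ^ n • α s) (α (φ s)) (α (φ t)) (a ^ n • α t)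
      have := hφ s
      have := hφ t
      rw [dist_comm (α (φ t))] at *
      linarith
    · have := dist_triangle4 (α (φ s)) (a ^ n • α s) (a ^ n • α t) (α (φ t))
      have := hφ s
      have := hφ t
      rw [dist_comm (α (φ s)) (a ^ n • α s)] at *
      linarith)
  refine ⟨ε, φ 0, hε, fun t => ?_⟩
  have e1 := dist_triangle (a ^ n • α t) (α (φ t)) (α (φ 0 + ε * t))
  rw [hα.dist_real, ← sub_sub] at e1
  have := hε' t
  have := hφ t
  linarith

/-- A hyperbolic isometry acts on its suitably oriented quasi-axis, up to a bounded error, as a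
translation. -/
theorem IsDeltaHyperbolic.exists_translation_axis [Nonempty Γ] (h : IsDeltaHyperbolic Γ δ) {a : G}
    {α : ℝ → Γ} (hhyp : IsHyperbolicIsometry Γ a) (ha : IsQuasiAxis a α) :
    ∃ α' : ℝ → Γ, Isometry α' ∧ Set.range α' = Set.range α ∧
      ∀ (i : ℤ) (t : ℝ), dist (a ^ i • α' t) (α' (t + i * translationLength Γ a)) ≤ 72 * δ := by
  have hα := ha.1
  have hδ := h.nonneg
  have hT := hhyp.translationLength_pos
  set T := translationLength Γ a with hTdef
  choose ε σ hε hσ using h.exists_shift ha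
  have hcomp : ∀ i j, ε (i + j) = ε i * ε j ∧ |σ (i + j) - (σ i + ε i * σ j)| ≤ 54 * δ := by
    intro i j
    -- A bounded affine function of `t` has slope zero, so one estimate shows that `ε` is
    -- multiplicative and `σ` is a quasi-cocycle.
    have key : ∀ t, |(σ (i + j) - (σ i + ε i * σ j)) + (ε (i + j) - ε i * ε j) * t| ≤ 54 * δ := by
      intro t
      have h1 := hσ (i + j) t
      have h2 := hσ i (σ j + ε j * t)
      have h3 := hσ j t
      rw [← dist_smul (a ^ i), ← mul_smul, ← pow_add] at h3
      have h4 := dist_triangle4 (α (σ (i + j) + ε (i + j) * t)) (a ^ (i + j) • α t)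
        (a ^ i • α (σ j + ε j * t)) (α (σ i + ε i * (σ j + ε j * t)))
      rw [hα.dist_real, dist_comm _ (a ^ (i + j) • α t)] at h4
      refine le_trans (le_of_eq ?_) (h4.trans (by linarith))
      congr 1
      ring
    exact ⟨sub_eq_zero.mp (eq_zero_of_forall_abs_add_mul_le key), by simpa using key 0⟩
  have hdist : ∀ i, |dist (α 0) (a ^ i • α 0) - (|σ i|)| ≤ 18 * δ := by
    intro i
    have h1 := hσ i 0
    rw [mul_zero, add_zero] at h1
    have h2 := hα.dist_real 0 (σ i)
    rw [zero_sub, abs_neg] at h2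
    rw [← h2]
    have := dist_dist_dist_le (α 0) (a ^ i • α 0) (α 0) (α (σ i))
    rw [dist_self, zero_add, Real.dist_eq] at this
    exact this.trans h1
  -- If `a` reversed the line, computing the shift of `a ^ (2 * n + 1)` in two orders would bound `σ
  -- (2 * n)`, against positive translation length.
  have hε1 : ε 1 = 1 := by
    by_contra hne
    have hε1 : ε 1 = -1 := (hε 1).resolve_left hne
    obtain ⟨n, hn⟩ := exists_nat_gt (72 * δ / T)
    rw [div_lt_iff₀ hT] at hn
    have h1 : ε (n + n) = 1 := by
      rw [(hcomp n n).1]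
      rcases hε n with h | h <;> rw [h] <;> norm_num
    have h2 := abs_le.mp (hcomp 1 (n + n)).2
    have h3 := abs_le.mp (hcomp (n + n) 1).2
    rw [add_comm, hε1] at h2
    rw [h1] at h3
    have h4 : |σ (n + n)| ≤ 54 * δ := abs_le.mpr ⟨by linarith, by linarith⟩
    have h5 := (abs_le.mp (hdist (n + n))).2
    have h6 := translationLength_le_dist a (α 0) (n + n)
    push_cast at h6
    have : 0 ≤ (n : ℝ) * T := by positivity
    linarith
  have hεi : ∀ i, 1 ≤ i → ε i = 1 := by
    intro i hi
    induction i, hi using Nat.le_induction with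
    | base => exact hε1
    | succ i _ ih => rw [(hcomp i 1).1, ih, hε1, one_mul]
  have hε' : ∀ i, ε i = 1 := by
    intro i
    have := (hcomp i 1).1
    rw [hε1, mul_one, hεi _ (by omega)] at this
    exact this.symm
  obtain ⟨η, hη, hη'⟩ := exists_sign_of_quasiadditive (σ := σ) (E := 54 * δ) (T := T)
    (fun i j => by simpa [hε'] using (hcomp i j).2) (by
      have h1 : Tendsto (fun n : ℕ => (18 * δ) / (n : ℝ)) atTop (𝓝 0) :=
        tendsto_const_div_atTop_nhds_zero_nat _
      have h2 : Tendsto (fun n : ℕ => dist (α 0) (a ^ n • α 0) / n - |σ n| / n) atTop (𝓝 0) := by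
        refine squeeze_zero_norm (fun n => ?_) h1
        rw [Real.norm_eq_abs, ← sub_div, abs_div, Nat.abs_cast]
        gcongr
        exact hdist n
      simpa using (tendsto_translationLength a (α 0)).sub h2)
  have hnat : ∀ (i : ℕ) (t : ℝ), dist (a ^ i • α t) (α (t + η * (i * T))) ≤ 72 * δ := by
    intro i t
    have h1 := hσ i t
    have h2 := dist_triangle (a ^ i • α t) (α (σ i + ε i * t)) (α (t + η * (i * T)))
    rw [hα.dist_real, hε', show σ i + 1 * t - (t + η * (i * T)) = σ i - η * (i * T) by ring] at h2
    have := hη' i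
    rw [hε'] at h1
    linarith
  have hηη : η * η = 1 := by rcases hη with rfl | rfl <;> norm_num
  refine ⟨fun t => α (η * t), Isometry.of_dist_eq fun s t => ?_, ?_, ?_⟩
  · rw [hα.dist_real, Real.dist_eq, ← mul_sub, abs_mul]
    rcases hη with rfl | rfl <;> simp
  · ext x
    constructor
    · rintro ⟨t, rfl⟩
      exact ⟨_, rfl⟩
    · rintro ⟨t, rfl⟩
      exact ⟨η * t, by simp [← mul_assoc, hηη]⟩
  · intro i t
    obtain ⟨m, rfl | rfl⟩ := i.eq_nat_or_neg
    · simpa [mul_add] using hnat m (η * t)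
    · rw [zpow_neg, zpow_natCast, ← dist_smul (a ^ m), smul_inv_smul, dist_comm]
      have := hnat m (η * (t + ((-(m : ℤ) : ℤ) : ℝ) * T))
      rwa [show η * (t + ((-(m : ℤ) : ℤ) : ℝ) * T) + η * (m * T) = η * t by push_cast; ring] at this

end Axis

/-! ### Local structure of metric graphs: open edges, vertices on lines, distances between vertices.
-/

section Graph

theorem EdgeChain.nonneg {Γ E : Type u} {c : E → unitInterval → Γ} {x y : Γ} {r : ℝ}
    (h : EdgeChain c x y r) : 0 ≤ r := by
  induction h with
  | nil => exact le_rfl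
  | cons e s t h ih => positivity

variable {Γ : Type u} [MetricSpace Γ]

namespace MetricGraph

variable (X : MetricGraph Γ)

theorem dist_char_le (e : X.Edge) (s t : unitInterval) :
    dist (X.char e s) (X.char e t) ≤ |(s : ℝ) - t| := by
  have := (X.isGLB_dist (X.char e s) (X.char e t)).1 (EdgeChain.cons e s t (EdgeChain.nil _))
  simpa using this

theorem char_mem_of_not {e : X.Edge} {t : unitInterval} (h : ¬(0 < t ∧ t < 1)) :
    X.char e t ∈ X.vertices := by
  by_cases h0 : 0 < t
  · have : t = 1 := le_antisymm unitInterval.le_one' (not_lt.mp fun h1 => h ⟨h0, h1⟩)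
    exact this ▸ X.char_one_mem e
  · have : t = 0 := le_antisymm (not_lt.mp h0) unitInterval.nonneg'
    exact this ▸ X.char_zero_mem e

theorem char_inj {e e' : X.Edge} {t t' : unitInterval} (h0 : 0 < t) (h1 : t < 1)
    (h : X.char e' t' = X.char e t) : e' = e ∧ t' = t := by
  have hv := X.char_notMem e t h0 h1
  have h' : 0 < t' ∧ t' < 1 := by
    by_contra hn
    exact hv (h ▸ X.char_mem_of_not hn)
  have := (X.existsUnique_char _ hv).unique (y₁ := (e', t')) (y₂ := (e, t)) ⟨h'.1, h'.2, h⟩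
    ⟨h0, h1, rfl⟩
  exact Prod.mk_inj.mp this

/-- A chain too short to reach an end of its initial edge never leaves that open edge. -/
theorem exists_char_of_edgeChain {x y : Γ} {r : ℝ} (h : EdgeChain X.char x y r) :
    ∀ (e : X.Edge) (t : unitInterval), 0 < t → t < 1 → X.char e t = x →
      r < min (t : ℝ) (1 - t) → ∃ s : unitInterval, 0 < s ∧ s < 1 ∧ X.char e s = y ∧
        |(t : ℝ) - s| ≤ r := by
  induction h with
  | nil x => exact fun e t h0 h1 hx hr => ⟨t, h0, h1, hx, by simp⟩
  | @cons e' s' t' y r h ih =>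
    intro e t h0 h1 hx hr
    obtain ⟨rfl, rfl⟩ := X.char_inj h0 h1 hx.symm
    have hr0 := h.nonneg
    obtain ⟨hr1, hr2⟩ := lt_min_iff.mp hr
    obtain ⟨hs1, hs2⟩ := abs_le.mp (le_refl |(s' : ℝ) - t'|)
    have h0' : 0 < t' := by
      rw [← unitInterval.coe_pos]
      linarith
    have h1' : t' < 1 := by
      rw [← unitInterval.coe_lt_one]
      linarith
    obtain ⟨s, hs0, hs1', hs, hst⟩ := ih e' t' h0' h1' rfl (lt_min (by linarith) (by linarith))
    exact ⟨s, hs0, hs1', hs, (abs_sub_le _ (t' : ℝ) _).trans (by linarith)⟩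

theorem exists_char_of_dist_lt {e : X.Edge} {t : unitInterval} (h0 : 0 < t) (h1 : t < 1) {y : Γ}
    (hy : dist (X.char e t) y < min (t : ℝ) (1 - t)) :
    ∃ s : unitInterval, 0 < s ∧ s < 1 ∧ X.char e s = y ∧ |(t : ℝ) - s| = dist (X.char e t) y := by
  have hglb := X.isGLB_dist (X.char e t) y
  obtain ⟨r, hr, -, hr'⟩ := hglb.exists_between hy
  obtain ⟨s, hs0, hs1, rfl, -⟩ := X.exists_char_of_edgeChain hr e t h0 h1 rfl hr'
  refine ⟨s, hs0, hs1, rfl, le_antisymm ?_ (X.dist_char_le e t s)⟩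
  refine le_of_forall_pos_lt_add fun ε hε => ?_
  obtain ⟨r, hr, -, hr'⟩ := hglb.exists_between (lt_min hy (lt_add_of_pos_right _ hε))
  obtain ⟨s', hs0', hs1', hs, hs'⟩ := X.exists_char_of_edgeChain hr e t h0 h1 rfl
    (hr'.trans_le (min_le_left _ _))
  rw [(X.char_inj hs0 hs1 hs).2] at hs'
  exact hs'.trans_lt (hr'.trans_le (min_le_right _ _))

theorem isOpen_openEdge (e : X.Edge) :
    IsOpen {x | ∃ t : unitInterval, 0 < t ∧ t < 1 ∧ X.char e t = x} := by
  rw [Metric.isOpen_iff]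
  rintro _ ⟨t, h0, h1, rfl⟩
  refine ⟨min (t : ℝ) (1 - t), lt_min (unitInterval.coe_pos.mpr h0)
    (sub_pos.mpr (unitInterval.coe_lt_one.mpr h1)), fun y hy => ?_⟩
  rw [Metric.mem_ball, dist_comm] at hy
  obtain ⟨s, hs0, hs1, hs, -⟩ := X.exists_char_of_dist_lt h0 h1 hy
  exact ⟨s, hs0, hs1, hs⟩

/-- Open edges are open and disjoint, so a connected piece without vertices lies in one of them; but
points of one open edge are at distance less than one. -/
theorem exists_vertex_mem_line {γ : ℝ → Γ} (hγ : Isometry γ) (a : ℝ) :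
    ∃ s ∈ Set.Icc a (a + 1), γ s ∈ X.vertices := by
  by_contra! hno
  have hedge : ∀ s ∈ Set.Icc a (a + 1), ∃ (e : X.Edge) (t : unitInterval),
      0 < t ∧ t < 1 ∧ X.char e t = γ s := fun s hs => by
    obtain ⟨⟨e, t⟩, h, -⟩ := X.existsUnique_char _ (hno s hs)
    exact ⟨e, t, h⟩
  have ha : a ∈ Set.Icc a (a + 1) := ⟨le_rfl, by linarith⟩
  have ha1 : a + 1 ∈ Set.Icc a (a + 1) := ⟨by linarith, le_rfl⟩
  obtain ⟨e, t, h0, h1, hea⟩ := hedge a ha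
  obtain ⟨e', t', h0', h1', hea'⟩ := hedge (a + 1) ha1
  by_cases hee : e' = e
  · subst hee
    have hd := X.dist_char_le e' t t'
    rw [hea, hea', hγ.dist_real, show a - (a + 1) = -1 by ring, abs_neg, abs_one] at hd
    have := unitInterval.coe_pos.mpr h0
    have := unitInterval.coe_lt_one.mpr h1
    have := unitInterval.coe_pos.mpr h0'
    have := unitInterval.coe_lt_one.mpr h1'
    have : |(t : ℝ) - t'| < 1 := abs_lt.mpr ⟨by linarith, by linarith⟩
    linarith
  · have hpre : IsPreconnected (γ '' Set.Icc a (a + 1)) :=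
      isPreconnected_Icc.image _ hγ.continuous.continuousOn
    obtain ⟨x, -, ⟨s, hs0, hs1, hs⟩, hx⟩ := hpre _
      (⋃ e' ∈ {e' : X.Edge | e' ≠ e}, {x | ∃ t : unitInterval, 0 < t ∧ t < 1 ∧ X.char e' t = x})
      (X.isOpen_openEdge e) (isOpen_biUnion fun e' _ => X.isOpen_openEdge e') (by
        rintro _ ⟨s, hs, rfl⟩
        obtain ⟨e₁, t₁, h⟩ := hedge s hs
        by_cases he : e₁ = e
        · exact Or.inl ⟨t₁, he ▸ h⟩
        · exact Or.inr (Set.mem_biUnion he ⟨t₁, h⟩))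
      ⟨_, ⟨a, ha, rfl⟩, t, h0, h1, hea⟩
      ⟨_, ⟨a + 1, ha1, rfl⟩, Set.mem_biUnion hee ⟨t', h0', h1', hea'⟩⟩
    obtain ⟨e₁, he₁, s', -, -, hs'⟩ := Set.mem_iUnion₂.mp hx
    exact he₁ (X.char_inj hs0 hs1 (hs'.trans hs.symm)).1

/-- A point that is not a vertex has only two directions. -/
theorem exists_radius_of_notMem {v : Γ} (hv : v ∉ X.vertices) :
    ∃ ρ > 0, ∀ ε < ρ, ∀ a b c : Γ, dist v a = ε → dist v b = ε → dist v c = ε →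
      a = b ∨ a = c ∨ b = c := by
  obtain ⟨⟨e, t⟩, ⟨h0, h1, rfl⟩, -⟩ := X.existsUnique_char v hv
  refine ⟨min (t : ℝ) (1 - t), lt_min (unitInterval.coe_pos.mpr h0)
    (sub_pos.mpr (unitInterval.coe_lt_one.mpr h1)), fun ε hε a b c ha hb hc => ?_⟩
  have key : ∀ a, dist (X.char e t) a = ε → ∃ s : unitInterval, X.char e s = a ∧
      ((s : ℝ) = t - ε ∨ (s : ℝ) = t + ε) := by
    intro a ha
    obtain ⟨s, -, -, hs, hst⟩ := X.exists_char_of_dist_lt h0 h1 (ha.trans_lt hε)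
    refine ⟨s, hs, ?_⟩
    rw [ha] at hst
    rcases abs_cases ((t : ℝ) - s) with ⟨h, -⟩ | ⟨h, -⟩ <;> rw [h] at hst
    · left; linarith
    · right; linarith
  obtain ⟨p, rfl, hp⟩ := key a ha
  obtain ⟨q, rfl, hq⟩ := key b hb
  obtain ⟨r, rfl, hr⟩ := key c hc
  have heq : ∀ {p q : unitInterval}, (p : ℝ) = q → X.char e p = X.char e q := fun h => by
    rw [Subtype.ext h]
  -- Pigeonhole: three points, but only the two coordinates `t - ε` and `t + ε`.
  rcases hp with hp | hp <;> rcases hq with hq | hq <;> rcases hr with hr | hr <;>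
    first
    | exact Or.inl (heq (hp.trans hq.symm))
    | exact Or.inr (Or.inl (heq (hp.trans hr.symm)))
    | exact Or.inr (Or.inr (heq (hq.trans hr.symm)))

open Classical in
-- The left side is a potential that changes along an edge by at most the length travelled. At a
-- vertex, which several pairs `(e, t)` may represent, it is `0` at `y` and `1` elsewhere; `hvert`
-- passes between representations.
theorem min_le_of_edgeChain {x y : Γ} {r : ℝ} (h : EdgeChain X.char x y r)
    (hy : y ∈ X.vertices) : ∀ (e : X.Edge) (t : unitInterval), X.char e t = x →
      min ((t : ℝ) + if X.char e 0 = y then 0 else 1)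
        (1 - t + if X.char e 1 = y then 0 else 1) ≤ r := by
  have hvert : ∀ (x : Γ) (r : ℝ), 0 ≤ r → (x ∈ X.vertices → x ≠ y → 1 ≤ r) → x ∈ X.vertices →
      ∀ (e : X.Edge) (t : unitInterval), X.char e t = x →
      min ((t : ℝ) + if X.char e 0 = y then 0 else 1)
        (1 - t + if X.char e 1 = y then 0 else 1) ≤ r := by
    intro x r hr h1 hx e t ht
    have ht' : t = 0 ∨ t = 1 := by
      by_contra! hne
      exact X.char_notMem e t (unitInterval.pos_iff_ne_zero.mpr hne.1)
        (unitInterval.lt_one_iff_ne_one.mpr hne.2) (ht ▸ hx)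
    by_cases hxy : x = y
    · rcases ht' with rfl | rfl
      · exact (min_le_left _ _).trans (by simp [ht, hxy, hr])
      · exact (min_le_right _ _).trans (by simp [ht, hxy, hr])
    · have := h1 hx hxy
      rcases ht' with rfl | rfl
      · exact (min_le_left _ _).trans (by simp [ht, hxy, this])
      · exact (min_le_right _ _).trans (by simp [ht, hxy, this])
  induction h with
  | nil x => exact hvert x 0 le_rfl (fun _ h => absurd rfl h) hy
  | @cons e' s' t' y r h ih =>
    intro e t ht
    have h1 := ih hy hvert e' t' rfl
    have hr := h.nonneg
    have hs1 := neg_abs_le ((s' : ℝ) - t')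
    have hs2 := le_abs_self ((s' : ℝ) - t')
    have key : min ((s' : ℝ) + if X.char e' 0 = y then 0 else 1)
        (1 - s' + if X.char e' 1 = y then 0 else 1) ≤ |(s' : ℝ) - t'| + r := by
      rcases min_le_iff.mp h1 with h1 | h1
      · exact (min_le_left _ _).trans (by linarith)
      · exact (min_le_right _ _).trans (by linarith)
    by_cases hv : X.char e' s' ∈ X.vertices
    · refine hvert _ _ (by positivity) (fun _ hne => le_trans ?_ key) hv e t ht
      have hs' : s' = 0 ∨ s' = 1 := by
        by_contra! hne
        exact X.char_notMem e' s' (unitInterval.pos_iff_ne_zero.mpr hne.1)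
          (unitInterval.lt_one_iff_ne_one.mpr hne.2) hv
      rcases hs' with rfl | rfl
      · refine le_min (by simp [hne]) ?_
        split_ifs <;> simp
      · refine le_min ?_ (by simp [hne])
        split_ifs <;> simp
    · have hin : 0 < s' ∧ s' < 1 := by
        by_contra hn
        exact hv (X.char_mem_of_not hn)
      obtain ⟨rfl, rfl⟩ := X.char_inj hin.1 hin.2 ht
      exact key

theorem one_le_dist_of_vertices {x y : Γ} (hx : x ∈ X.vertices) (hy : y ∈ X.vertices)
    (hxy : x ≠ y) : 1 ≤ dist x y := by
  classical
  refine (le_isGLB_iff (X.isGLB_dist x y)).mpr ?_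
  intro r hr
  cases hr with
  | nil => exact absurd rfl hxy
  | cons e s t h =>
    have hs' : s = 0 ∨ s = 1 := by
      by_contra! hne
      exact X.char_notMem e s (unitInterval.pos_iff_ne_zero.mpr hne.1)
        (unitInterval.lt_one_iff_ne_one.mpr hne.2) hx
    refine le_trans ?_ (X.min_le_of_edgeChain (EdgeChain.cons e s t h) hy e s rfl)
    rcases hs' with rfl | rfl
    · refine le_min (by simp [hxy]) ?_
      split_ifs <;> simp
    · refine le_min ?_ (by simp [hxy])
      split_ifs <;> simp

end MetricGraph

end Graph

/-! ### Acylindricity for displacements larger than `20 * δ`. -/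

section Acylindrical

variable {Γ : Type u} [MetricSpace Γ] {δ : ℝ} {G : Type v} [Group G] [MulAction G Γ]
  [IsIsometricSMul G Γ] {X : MetricGraph Γ} {K L : ℝ → ℝ}

/-- If `k` moves two points of a line little, then it moves the points between them close to the
same line, and little along it. -/
theorem IsDeltaHyperbolic.exists_near_smul (h : IsDeltaHyperbolic Γ δ) {γ : ℝ → Γ}
    (hγ : Isometry γ) {R s t u : ℝ} (hsu : R + 2 * δ < u - s) (hut : R + 2 * δ < t - u) {k : G}
    (hs : dist (γ s) (k • γ s) ≤ R) (ht : dist (γ t) (k • γ t) ≤ R) :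
    ∃ r, dist (k • γ u) (γ r) ≤ 2 * δ ∧ |r - u| ≤ R + 2 * δ := by
  have : Nonempty Γ := ⟨γ 0⟩
  have hδ := h.nonneg
  have hR := dist_nonneg.trans hs
  have e1 := hγ.dist_real u s
  have e2 := hγ.dist_real u t
  rw [abs_of_nonneg (by linarith), ← dist_smul k] at e1
  rw [abs_of_nonpos (by linarith), ← dist_smul k] at e2
  obtain ⟨q, hq, ⟨r, rfl⟩ | hq' | hq'⟩ := h.quadrilateral (isometry_smul_line k hγ) hγ (u := u)
    (t₁ := s) (t₂ := t) ⟨by linarith, by linarith⟩ s t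
  · refine ⟨r, hq, abs_le.mpr ⟨?_, ?_⟩⟩
    · have e3 := hγ.dist_real r t
      have e4 := dist_triangle4 (γ r) (k • γ u) (k • γ t) (γ t)
      have e5 := neg_le_abs (r - t)
      rw [dist_comm (γ r) (k • γ u), dist_comm (k • γ t) (γ t)] at e4
      linarith
    · have e3 := hγ.dist_real r s
      have e4 := dist_triangle4 (γ r) (k • γ u) (k • γ s) (γ s)
      have e5 := le_abs_self (r - s)
      rw [dist_comm (γ r) (k • γ u), dist_comm (k • γ s) (γ s)] at e4
      linarith
  · have e3 := dist_triangle (k • γ u) q (k • γ s)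
    have e4 := dist_nonneg (x := q) (y := γ s)
    rw [dist_comm (k • γ s) (γ s)] at hq'
    rw [dist_comm q (k • γ s)] at e3
    linarith
  · have e3 := dist_triangle (k • γ u) q (k • γ t)
    have e4 := dist_nonneg (x := q) (y := γ t)
    rw [dist_comm (k • γ t) (γ t)] at hq'
    rw [dist_comm q (k • γ t)] at e3
    linarith

/-- Two numbers in the same cell of width `d` differ by at most `d`. The case `d = 0` is needed for
trees: division by zero makes a single cell, and `a = b = u`. -/
theorem abs_sub_le_of_floor_div_eq {a b u R d : ℝ} (hd : 0 ≤ d) (ha : |a - u| ≤ R * d)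
    (hb : |b - u| ≤ R * d) (hab : ⌊(a - u) / d⌋ = ⌊(b - u) / d⌋) : |a - b| ≤ d := by
  rcases hd.eq_or_lt with rfl | hd
  · rw [mul_zero] at ha hb
    have h1 := abs_nonpos_iff.mp ha
    have h2 := abs_nonpos_iff.mp hb
    rw [show a - b = (a - u) - (b - u) by ring, h1, h2]
    simp
  · have := Int.abs_sub_lt_one_of_floor_eq_floor hab
    rw [← sub_div, abs_div, abs_of_pos hd, div_lt_one hd] at this
    exact (by simpa using this.le)

theorem floor_div_mem_Icc {a u d : ℝ} {R : ℕ} (hd : 0 ≤ d) (ha : |a - u| ≤ R * d) :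
    ⌊(a - u) / d⌋ ∈ Finset.Icc (-(R : ℤ)) R := by
  have h1 := abs_le.mp ha
  rw [Finset.mem_Icc]
  constructor
  · rw [Int.le_floor]
    push_cast
    rcases hd.eq_or_lt with rfl | hd
    · simp
    · rw [le_div_iff₀ hd]
      linarith
  · have : (a - u) / d ≤ R := div_le_of_le_mul₀ hd (by positivity) h1.2
    exact_mod_cast (Int.floor_le _).trans this

/-- In an acylindrical action, few elements move both ends of a long segment of a line little. -/
theorem IsDeltaHyperbolic.card_le_of_acylindrical (h : IsDeltaHyperbolic Γ δ)
    (hac : IsAcylindrical X G K L) {γ : ℝ → Γ} (hγ : Isometry γ) {c : ℕ} {s t : ℝ}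
    (hst : L (20 * δ) + 2 * ((c + 2) * δ) + 4 ≤ t - s) {F : Finset G}
    (hF : ∀ k ∈ F, dist (γ s) (k • γ s) ≤ c * δ ∧ dist (γ t) (k • γ t) ≤ c * δ) :
    (F.card : ℝ) ≤ (2 * c + 5) ^ 2 * K (20 * δ) := by
  classical
  have : Nonempty Γ := ⟨γ 0⟩
  have hδ := h.nonneg
  obtain ⟨hK, hL, hac⟩ := hac (20 * δ) (by linarith)
  -- Acylindricity speaks of vertices. These two lie far enough inside `[s, t]` for
  -- `exists_near_smul`, and still at least `L (20 * δ)` apart.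
  obtain ⟨u, hu, huv⟩ := X.exists_vertex_mem_line hγ (s + ((c + 2) * δ + 1))
  obtain ⟨v, hv, hvv⟩ := X.exists_vertex_mem_line hγ (t - ((c + 2) * δ + 2))
  have huv' : L (20 * δ) ≤ dist (γ u) (γ v) := by
    rw [hγ.dist_real, abs_sub_comm]
    exact le_trans (by linarith [hu.2, hv.1]) (le_abs_self _)
  obtain ⟨hfin, hcard⟩ := hac _ huv _ hvv huv'
  set A := {g : G | dist (γ u) (g • γ u) ≤ 20 * δ ∧ dist (γ v) (g • γ v) ≤ 20 * δ}
  have hcδ : 0 ≤ (c + 2) * δ := by positivity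
  have hex : ∀ w, s + ((c + 2) * δ + 1) ≤ w → w ≤ t - ((c + 2) * δ + 1) → ∀ k : G, ∃ r, k ∈ F →
      dist (k • γ w) (γ r) ≤ 2 * δ ∧ |r - w| ≤ ((c + 2 : ℕ) : ℝ) * δ := by
    intro w h1 h2 k
    by_cases hk : k ∈ F
    · obtain ⟨r, hr, hr'⟩ := h.exists_near_smul hγ (R := c * δ) (s := s) (t := t) (u := w)
        (by linarith) (by linarith) (hF k hk).1 (hF k hk).2
      exact ⟨r, fun _ => ⟨hr, by push_cast; linarith⟩⟩
    · exact ⟨0, fun h => absurd h hk⟩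
  choose p hp using hex u hu.1 (by linarith [hu.2, hv.1])
  choose q hq using hex v (by linarith [hu.2, hv.1]) (by linarith [hv.2])
  by_contra! hlt
  set B : Finset ℤ := Finset.Icc (-((c + 2 : ℕ) : ℤ)) ((c + 2 : ℕ) : ℤ)
  have hB : B.card = 2 * c + 5 := by
    rw [Int.card_Icc]
    push_cast
    omega
  -- The shifts at `u` and `v` are sorted into `2 * c + 5` cells of width `δ` each. Elements `k₀`,
  -- `k` in the same pair of cells differ by `k₀⁻¹ * k`, which moves both vertices by at most `2δ +
  -- δ + 2δ`.
  obtain ⟨y, -, hy⟩ := Finset.exists_lt_card_fiber_of_mul_lt_card_of_maps_to (s := F)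
    (t := B ×ˢ B) (f := fun k => (⌊(p k - u) / δ⌋, ⌊(q k - v) / δ⌋)) (n := ⌊K (20 * δ)⌋₊)
    (fun k hk => Finset.mem_product.mpr
      ⟨floor_div_mem_Icc hδ (hp k hk).2, floor_div_mem_Icc hδ (hq k hk).2⟩) (by
    rw [Finset.card_product, hB]
    have h1 : (⌊K (20 * δ)⌋₊ : ℝ) ≤ K (20 * δ) := Nat.floor_le (by linarith)
    have h2 : ((2 * c + 5) * (2 * c + 5) * ⌊K (20 * δ)⌋₊ : ℝ) < F.card := by
      refine lt_of_le_of_lt ?_ hlt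
      rw [sq]
      gcongr
    exact_mod_cast h2)
  set Φ := F.filter fun k => (⌊(p k - u) / δ⌋, ⌊(q k - v) / δ⌋) = y with hΦ
  have hΦK : K (20 * δ) < Φ.card := by
    rw [← Nat.floor_lt (by linarith)]
    exact hy
  obtain ⟨k₀, hk₀⟩ : Φ.Nonempty := Finset.card_pos.mp (by omega)
  have hsub : (↑(Φ.image fun k => k₀⁻¹ * k) : Set G) ⊆ A := by
    rw [Finset.coe_image]
    rintro _ ⟨k, hk, rfl⟩
    obtain ⟨hkF, hky⟩ := Finset.mem_filter.mp hk
    obtain ⟨hk₀F, hk₀y⟩ := Finset.mem_filter.mp hk₀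
    have hb := Prod.mk_inj.mp (hk₀y.trans hky.symm)
    have move : ∀ (w : ℝ) (r : G → ℝ), (∀ k ∈ F, dist (k • γ w) (γ (r k)) ≤ 2 * δ ∧
        |r k - w| ≤ ((c + 2 : ℕ) : ℝ) * δ) → ⌊(r k₀ - w) / δ⌋ = ⌊(r k - w) / δ⌋ →
        dist (γ w) ((k₀⁻¹ * k) • γ w) ≤ 20 * δ := by
      intro w r hr heq
      have h1 := abs_sub_le_of_floor_div_eq hδ (hr k₀ hk₀F).2 (hr k hkF).2 heq
      rw [← dist_smul k₀, mul_smul, smul_inv_smul]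
      have h2 := dist_triangle4 (k₀ • γ w) (γ (r k₀)) (γ (r k)) (k • γ w)
      rw [hγ.dist_real, dist_comm (γ (r k))] at h2
      linarith [(hr k₀ hk₀F).1, (hr k hkF).1]
    exact ⟨move u p hp hb.1, move v q hq hb.2⟩
  have h1 := Set.ncard_le_ncard hsub hfin
  rw [Set.ncard_coe_finset, Finset.card_image_of_injective _ (mul_right_injective k₀⁻¹)] at h1
  have : (Φ.card : ℝ) ≤ A.ncard := by exact_mod_cast h1
  linarith

end Acylindrical

/-! ### Bounded overlap implies bounded projection. -/

section Overlap

variable {Γ : Type u} [MetricSpace Γ] {δ : ℝ}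

theorem dist_le_of_ediam_le {S : Set Γ} {D : ℝ} (hD : 0 ≤ D)
    (h : Metric.ediam S ≤ ENNReal.ofReal D) {x y : Γ} (hx : x ∈ S) (hy : y ∈ S) : dist x y ≤ D := by
  have := (Metric.edist_le_ediam_of_mem hx hy).trans h
  rwa [edist_dist, ENNReal.ofReal_le_ofReal_iff hD] at this

/-- A line whose overlap with `α` is bounded leaves `α`. -/
theorem exists_notMem_range_of_overlap {α β : ℝ → Γ} (hβ : Isometry β) {r D : ℝ} (hr : 0 ≤ r)
    (hD : 0 ≤ D)
    (h : Metric.ediam (overlap r (Set.range α) (Set.range β)) ≤ ENNReal.ofReal D) :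
    ∃ s, β s ∉ Set.range α := by
  by_contra! hno
  have hmem : ∀ s, β s ∈ overlap r (Set.range α) (Set.range β) := fun s =>
    Or.inr ⟨⟨s, rfl⟩, β s, hno s, by simpa using hr⟩
  have := dist_le_of_ediam_le hD h (hmem 0) (hmem (D + 1))
  rw [hβ.dist_real, zero_sub, abs_neg, abs_of_nonneg (by linarith)] at this
  linarith

/-- Points of a line project into a set whose diameter is bounded in terms of the overlap. -/
theorem IsDeltaHyperbolic.abs_sub_le_of_overlap (h : IsDeltaHyperbolic Γ δ) {α β : ℝ → Γ}
    (hα : Isometry α) (hβ : Isometry β) {r D : ℝ} (hr : 2 * δ ≤ r) (hD : 0 ≤ D)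
    (hov : Metric.ediam (overlap r (Set.range α) (Set.range β)) ≤ ENNReal.ofReal D)
    {s₁ s₂ t₁ t₂ : ℝ} (h₁ : IsProj α (8 * δ) (β s₁) t₁) (h₂ : IsProj α (8 * δ) (β s₂) t₂) :
    |t₁ - t₂| ≤ D + 20 * δ := by
  wlog hle : t₁ ≤ t₂ generalizing s₁ s₂ t₁ t₂
  · rw [abs_sub_comm]
    exact this h₂ h₁ (le_of_not_ge hle)
  have : Nonempty Γ := ⟨α 0⟩
  have hδ := h.nonneg
  by_contra! hlt
  rw [abs_of_nonpos (by linarith)] at hlt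
  set e := (t₂ - t₁ - (D + 20 * δ)) / 4 with he
  have key : ∀ u, t₁ + 10 * δ < u → u < t₂ - 10 * δ →
      α u ∈ overlap r (Set.range α) (Set.range β) := fun u hu₁ hu₂ => by
    obtain ⟨s, hs⟩ := h.exists_near_of_isProj hα hβ (by linarith) h₁ h₂ (u := u) (by linarith)
      (by linarith)
    exact Or.inl ⟨⟨u, rfl⟩, β s, ⟨s, rfl⟩, by linarith⟩
  have := dist_le_of_ediam_le hD hov (key (t₁ + 10 * δ + e) (by linarith) (by linarith))
    (key (t₂ - 10 * δ - e) (by linarith) (by linarith))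
  rw [hα.dist_real, abs_of_nonpos (by linarith)] at this
  linarith

end Overlap

/-! ### Lower bounds on translation length, and long overlaps of translated axes. -/

section Axis

variable {Γ : Type u} [MetricSpace Γ] {δ : ℝ} {G : Type v} [Group G] [MulAction G Γ]
  [IsIsometricSMul G Γ] {X : MetricGraph Γ} {K L : ℝ → ℝ}

/-- In an acylindrical action the translation lengths are bounded below, relative to `δ`. -/
theorem IsDeltaHyperbolic.le_mul_translation (h : IsDeltaHyperbolic Γ δ)
    (hac : IsAcylindrical X G K L) {f : G} {α : ℝ → Γ} (hα : Isometry α) {T : ℝ} (hT : 0 < T)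
    (hf : ∀ (i : ℤ) (t : ℝ), dist (f ^ i • α t) (α (t + i * T)) ≤ 72 * δ)
    (hinj : ∀ i : ℕ, f ^ i = 1 → i = 0) {m : ℕ} (hm : 151 ^ 2 * K (20 * δ) < m + 1) :
    δ ≤ m * T := by
  classical
  have : Nonempty Γ := ⟨α 0⟩
  have hδ := h.nonneg
  by_contra! hlt
  -- The error `72 * δ` plus a shift below `δ`. The count for `c = 73` has the factor `(2 * 73 + 5)
  -- ^ 2 = 151 ^ 2`.
  have hmove : ∀ i : ℕ, i ≤ m → ∀ t, dist (α t) (f ^ i • α t) ≤ (73 : ℕ) * δ := by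
    intro i hi t
    have h1 := hf i t
    have h2 := dist_triangle (α t) (α (t + i * T)) (f ^ i • α t)
    have h3 : (i : ℝ) * T ≤ m * T := by gcongr
    rw [hα.dist_real, show t - (t + i * T) = -(i * T) by ring, abs_neg,
      abs_of_nonneg (by positivity), dist_comm (α (t + i * T))] at h2
    rw [zpow_natCast, Int.cast_natCast] at h1
    push_cast
    linarith
  have hpow : Function.Injective fun i : ℕ => f ^ i := by
    refine injective_pow_iff_not_isOfFinOrder.mpr fun hfin => ?_
    obtain ⟨n, hn, hn'⟩ := isOfFinOrder_iff_pow_eq_one.mp hfin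
    exact hn.ne' (hinj n hn')
  have hcard := h.card_le_of_acylindrical hac hα (c := 73) (s := 0)
    (t := L (20 * δ) + 2 * (((73 : ℕ) + 2) * δ) + 4)
    (by linarith) (F := (Finset.range (m + 1)).image fun i => f ^ i) (by
      intro k hk
      obtain ⟨i, hi, rfl⟩ := Finset.mem_image.mp hk
      have hi := Finset.mem_range.mp hi
      exact ⟨hmove i (by omega) _, hmove i (by omega) _⟩)
  rw [Finset.card_image_of_injective _ hpow, Finset.card_range] at hcard
  push_cast at hcard
  norm_num at hcard hm
  linarith

/-- In a tree that is not a line, the translation lengths are at least one. -/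
theorem IsDeltaHyperbolic.one_le_translation (h : IsDeltaHyperbolic Γ 0) (X : MetricGraph Γ)
    {f : G} {α : ℝ → Γ} (hα : Isometry α) {T : ℝ} (hT : 0 < T)
    (hf : ∀ t, f • α t = α (t + T)) {z : Γ} (hz : z ∉ Set.range α) : 1 ≤ T := by
  obtain ⟨t, ht, -⟩ := h.exists_isProj hα z
  simp only [IsProj, mul_zero, add_zero] at ht
  have hpos : 0 < dist (α t) z := dist_pos.mpr fun he => hz ⟨t, he⟩
  obtain ⟨σ, hσ⟩ := h.geodesic (α t) z
  -- The projection `α t` of a point off the line is a branch point: two directions along `α` and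
  -- one towards `z`. Its translates branch as well, so none lies inside an edge.
  have hvertex : ∀ k : G, k • α t ∈ X.vertices := by
    intro k
    by_contra hk
    obtain ⟨ρ, hρ, hρ'⟩ := X.exists_radius_of_notMem hk
    set ε := min (ρ / 2) (dist (α t) z) with hε
    have hε0 : 0 < ε := lt_min (by linarith) hpos
    have hεI : ε ∈ Set.Icc 0 (dist (α t) z) := ⟨hε0.le, min_le_right _ _⟩
    have hσε : dist (α t) (σ ε) = ε := by
      have := hσ.dist_eq 0 ⟨le_rfl, dist_nonneg⟩ ε hεI
      rwa [hσ.map_zero, zero_sub, abs_neg, abs_of_pos hε0] at this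
    have hline : ∀ s, |s - t| = ε → α s ≠ σ ε := by
      intro s hs he
      have h1 := ht s
      have h2 := hσ.dist_add hεI
      rw [hs, dist_comm z, dist_comm z, he] at h1
      linarith
    have ha : |(t + ε) - t| = ε := by rw [add_sub_cancel_left, abs_of_pos hε0]
    have hb : |(t - ε) - t| = ε := by rw [sub_sub_cancel_left, abs_neg, abs_of_pos hε0]
    rcases hρ' ε (lt_of_le_of_lt (min_le_left _ _) (by linarith)) (k • α (t + ε)) (k • α (t - ε))
      (k • σ ε) (by rw [dist_smul, dist_comm, hα.dist_real, ha])
      (by rw [dist_smul, dist_comm, hα.dist_real, hb]) (by rw [dist_smul, hσε]) with e | e | e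
    · have := hα.injective (MulAction.injective k e)
      linarith
    · exact hline _ ha (MulAction.injective k e)
    · exact hline _ hb (MulAction.injective k e)
  have h1 := hvertex 1
  have h2 := hvertex f
  rw [one_smul] at h1
  rw [hf] at h2
  have := X.one_le_dist_of_vertices h1 h2 fun he => by
    have := hα.injective he
    linarith
  rwa [hα.dist_real, show t - (t + T) = -T by ring, abs_neg, abs_of_pos hT] at this

/-- Conjugating twice cancels the sign. -/
theorem conj_zpow_eq {k f : G} {r η : ℤ} (hη : η = 1 ∨ η = -1)
    (h : k * f ^ r * k⁻¹ = f ^ (η * r)) : k ^ 2 * f ^ r = f ^ r * k ^ 2 := by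
  have h1 : k * (k * f ^ r * k⁻¹) * k⁻¹ = f ^ r := by
    rcases hη with rfl | rfl
    · rw [one_mul] at h
      rw [h, h]
    · have h2 := congrArg (·⁻¹) h
      simp only [neg_one_mul, zpow_neg, inv_inv, mul_inv_rev] at h h2
      rw [h, mul_assoc, h2]
  calc k ^ 2 * f ^ r = k * (k * f ^ r * k⁻¹) * k⁻¹ * k ^ 2 := by simp [sq, mul_assoc]
    _ = f ^ r * k ^ 2 := by rw [h1]

/-- If an axis `α` of `f` has a long overlap with its image under `k`, then `k` normalises a
nontrivial power of `f`. -/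
theorem IsDeltaHyperbolic.exists_conj_of_long_overlap (h : IsDeltaHyperbolic Γ δ)
    (hac : IsAcylindrical X G K L) {f : G} {α : ℝ → Γ} (hα : Isometry α) {T : ℝ} (hT : 0 < T)
    (hf : ∀ (i : ℤ) (t : ℝ), dist (f ^ i • α t) (α (t + i * T)) ≤ 72 * δ)
    {m : ℕ} (hm : 333 ^ 2 * K (20 * δ) < m + 1) {k : G} {s₁ s₂ t₁ t₂ : ℝ}
    (h₁ : dist (k • α s₁) (α t₁) ≤ 2 * δ) (h₂ : dist (k • α s₂) (α t₂) ≤ 2 * δ)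
    (hlong : m * T + L (20 * δ) + 336 * δ + 4 ≤ s₂ - s₁) :
    ∃ r : ℤ, r ≠ 0 ∧ ∃ η : ℤ, (η = 1 ∨ η = -1) ∧ k * f ^ r * k⁻¹ = f ^ (η * r) := by
  classical
  have : Nonempty Γ := ⟨α 0⟩
  have hδ := h.nonneg
  have hL := (hac (20 * δ) (by linarith)).2.1
  have hmT : 0 ≤ m * T := by positivity
  obtain ⟨η, hη, hηt⟩ : ∃ η : ℤ, (η = 1 ∨ η = -1) ∧ t₂ = t₁ + η * |t₁ - t₂| := by
    rcases le_total t₁ t₂ with hle | hle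
    · exact ⟨1, Or.inl rfl, by rw [abs_of_nonpos (by linarith)]; push_cast; ring⟩
    · exact ⟨-1, Or.inr rfl, by rw [abs_of_nonneg (by linarith)]; push_cast; ring⟩
  have hη' : |(η : ℝ)| = 1 := by rcases hη with rfl | rfl <;> simp
  set l := s₂ - s₁ with hl
  set l' := |t₁ - t₂| with hl'
  have hll' : l ≤ l' + 4 * δ := by
    have e1 := dist_triangle4 (k • α s₁) (α t₁) (α t₂) (k • α s₂)
    rw [dist_smul, hα.dist_real, hα.dist_real, dist_comm _ (k • α s₂), abs_sub_comm s₁,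
      abs_of_nonneg (by linarith)] at e1
    linarith
  have hclose : ∀ u, 0 ≤ u → u ≤ l - 4 * δ → dist (k • α (s₁ + u)) (α (t₁ + η * u)) ≤ 10 * δ := by
    intro u hu hul
    refine (h.fellow_travel (ρ := 2 * δ) (u := u) (l := l) (l' := l') (x := k • α s₁)
      (z := k • α s₂) (x' := α t₁) (z' := α t₂) ?_ ?_ ?_ ?_ ?_ ?_ h₁ h₂).trans (by linarith)
    · rw [dist_smul, hα.dist_real, show s₁ - (s₁ + u) = -u by ring, abs_neg, abs_of_nonneg hu]
    · rw [dist_smul, hα.dist_real, show s₁ + u - s₂ = -(l - u) by rw [hl]; ring, abs_neg,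
        abs_of_nonneg (by linarith)]
    · rw [dist_smul, hα.dist_real, abs_sub_comm, abs_of_nonneg (by linarith)]
    · rw [hα.dist_real, show t₁ - (t₁ + η * u) = -(η * u) by ring, abs_neg, abs_mul, hη', one_mul,
        abs_of_nonneg hu]
    · rw [hα.dist_real, hηt, show t₁ + η * u - (t₁ + η * l') = -(η * (l' - u)) by ring, abs_neg,
        abs_mul, hη', one_mul, abs_of_nonneg (by linarith)]
    · rw [hα.dist_real]
  -- Translating by `i * T` along `k • α` and back along `α` almost cancels where the lines
  -- fellow-travel. The error is `72 + 10 + 72 + 10 = 164` times `δ`, and `2 * 164 + 5 = 333`. A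
  -- coincidence `q i = q j` is the desired relation.
  set q : ℕ → G := fun i => f ^ (-(η * i)) * (k * f ^ (i : ℤ) * k⁻¹) with hq
  have hmove : ∀ i : ℕ, i ≤ m → ∀ u, 0 ≤ u → u + m * T ≤ l - 4 * δ →
      dist (k • α (s₁ + u)) (q i • k • α (s₁ + u)) ≤ (164 : ℕ) * δ := by
    intro i hi u hu hul
    have hiT : (i : ℝ) * T ≤ m * T := by gcongr
    have hiT0 : 0 ≤ (i : ℝ) * T := by positivity
    have e1 := hf i (s₁ + u)
    have e2 := hclose (u + i * T) (by linarith) (by linarith)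
    have e3 := hf (-(η * i)) (t₁ + η * (u + i * T))
    have e4 := hclose u hu (by linarith)
    rw [← dist_smul k, ← dist_smul (f ^ (-(η * i)))] at e1
    rw [← dist_smul (f ^ (-(η * i)))] at e2
    rw [show t₁ + η * (u + i * T) + ((-(η * i) : ℤ) : ℝ) * T = t₁ + η * u by push_cast; ring] at e3
    rw [Int.cast_natCast, add_assoc] at e1
    have e5 : q i • k • α (s₁ + u) = f ^ (-(η * i)) • k • f ^ (i : ℤ) • α (s₁ + u) := by
      simp only [hq, mul_smul, inv_smul_smul]
    rw [e5, dist_comm]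
    have e6 := dist_triangle4 (f ^ (-(η * i)) • k • f ^ (i : ℤ) • α (s₁ + u))
      (f ^ (-(η * i)) • k • α (s₁ + (u + i * T)))
      (f ^ (-(η * i)) • α (t₁ + η * (u + i * T))) (α (t₁ + η * u))
    have e7 := dist_triangle (f ^ (-(η * i)) • k • f ^ (i : ℤ) • α (s₁ + u)) (α (t₁ + η * u))
      (k • α (s₁ + u))
    rw [dist_comm (α (t₁ + η * u))] at e7
    push_cast
    linarith
  have hnot : ¬Set.InjOn q (Finset.range (m + 1)) := by
    intro hinj
    have hcard := h.card_le_of_acylindrical hac (isometry_smul_line k hα) (c := 164) (s := s₁)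
      (t := s₁ + (l - m * T - 4 * δ)) (by push_cast; linarith)
      (F := (Finset.range (m + 1)).image q) (by
        intro g hg
        obtain ⟨i, hi, rfl⟩ := Finset.mem_image.mp hg
        have hi := Finset.mem_range.mp hi
        refine ⟨?_, hmove i (by omega) _ (by linarith) (by linarith)⟩
        simpa using hmove i (by omega) 0 le_rfl (by linarith))
    rw [Finset.card_image_of_injOn hinj, Finset.card_range] at hcard
    push_cast at hcard
    norm_num at hcard hm
    linarith
  simp only [Set.InjOn, not_forall] at hnot
  obtain ⟨i, -, j, -, hij, hne⟩ := hnot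
  refine ⟨(j : ℤ) - i, by omega, η, hη, ?_⟩
  have e1 : k * f ^ ((j : ℤ) - i) * k⁻¹ = (k * f ^ (j : ℤ) * k⁻¹) * (k * f ^ (i : ℤ) * k⁻¹)⁻¹ := by
    rw [zpow_sub]
    group
  simp only [hq] at hij
  rw [zpow_neg, zpow_neg, inv_mul_eq_iff_eq_mul] at hij
  rw [e1, hij, mul_sub, zpow_sub]
  group

end Axis

/-! ### Reduced words in two generators, and freeness from displacement. -/

section Words

variable {G : Type v} [Group G]

/-- The word `x ^ a₁ * y ^ b₁ * ⋯ * x ^ aₖ * y ^ bₖ * x ^ c`. -/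
def syllableWord (x y : G) : List (ℤ × ℤ) → ℤ → G
  | [], c => x ^ c
  | s :: l, c => x ^ s.1 * y ^ s.2 * syllableWord x y l c

/-- No exponent vanishes, except possibly the first and the last one. -/
def IsReducedSyllables (l : List (ℤ × ℤ)) : Prop :=
  (∀ s ∈ l, s.2 ≠ 0) ∧ ∀ s ∈ l.tail, s.1 ≠ 0

theorem IsReducedSyllables.tail {s : ℤ × ℤ} {l : List (ℤ × ℤ)} (h : IsReducedSyllables (s :: l)) :
    IsReducedSyllables l :=
  ⟨fun t ht => h.1 t (List.mem_cons_of_mem _ ht), fun t ht => h.2 t (List.mem_of_mem_tail ht)⟩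

theorem map_syllableWord {H : Type*} [Group H] (φ : G →* H) (x y : G) (l : List (ℤ × ℤ)) (c : ℤ) :
    φ (syllableWord x y l c) = syllableWord (φ x) (φ y) l c := by
  induction l with
  | nil => simp [syllableWord]
  | cons s l ih => simp [syllableWord, ih]

theorem zpow_mul_syllableWord_of_left (x y : G) (e : ℤ) {l : List (ℤ × ℤ)} (hl : IsReducedSyllables l)
    (c : ℤ) : ∃ l' c', IsReducedSyllables l' ∧
      syllableWord x y l' c' = x ^ e * syllableWord x y l c := by
  rcases l with - | ⟨s, l⟩
  · exact ⟨[], e + c, hl, by simp [syllableWord, zpow_add]⟩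
  · refine ⟨(e + s.1, s.2) :: l, c, ⟨?_, hl.2⟩, by simp [syllableWord, zpow_add, mul_assoc]⟩
    intro t ht
    rcases List.mem_cons.mp ht with rfl | ht
    · exact hl.1 s List.mem_cons_self
    · exact hl.1 t (List.mem_cons_of_mem _ ht)

theorem zpow_mul_syllableWord_of_right (x y : G) {e : ℤ} (he : e ≠ 0) {l : List (ℤ × ℤ)}
    (hl : IsReducedSyllables l) (c : ℤ) : ∃ l' c', IsReducedSyllables l' ∧
      syllableWord x y l' c' = y ^ e * syllableWord x y l c := by
  rcases l with - | ⟨⟨a, b⟩, l⟩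
  · exact ⟨[(0, e)], c, ⟨by simpa using he, by simp⟩, by simp [syllableWord]⟩
  by_cases ha : a = 0
  · subst ha
    by_cases hb : e + b = 0
    · refine ⟨l, c, hl.tail, ?_⟩
      simp only [syllableWord, zpow_zero, one_mul]
      rw [← mul_assoc, ← zpow_add, hb, zpow_zero, one_mul]
    · refine ⟨(0, e + b) :: l, c, ⟨?_, hl.2⟩, by simp [syllableWord, zpow_add, mul_assoc]⟩
      intro t ht
      rcases List.mem_cons.mp ht with rfl | ht
      · exact hb
      · exact hl.1 t (List.mem_cons_of_mem _ ht)
  · refine ⟨(0, e) :: (a, b) :: l, c, ⟨?_, ?_⟩, by simp [syllableWord]⟩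
    · intro t ht
      rcases List.mem_cons.mp ht with rfl | ht
      · exact he
      · exact hl.1 t ht
    · intro t ht
      rcases List.mem_cons.mp ht with rfl | ht
      · exact ha
      · exact hl.2 t ht

theorem exists_syllableWord {x y h : G} (hh : h ∈ Subgroup.closure {x, y}) :
    ∃ l c, IsReducedSyllables l ∧ syllableWord x y l c = h := by
  have step : ∀ z ∈ ({x, y} : Set G), ∀ e : ℤ, e ≠ 0 → ∀ h : G,
      (∃ l c, IsReducedSyllables l ∧ syllableWord x y l c = h) →
      ∃ l c, IsReducedSyllables l ∧ syllableWord x y l c = z ^ e * h := by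
    rintro z (rfl | rfl) e he _ ⟨l, c, hl, rfl⟩
    · exact zpow_mul_syllableWord_of_left _ _ _ hl c
    · exact zpow_mul_syllableWord_of_right _ _ he hl c
  induction hh using Subgroup.closure_induction_left with
  | one => exact ⟨[], 0, ⟨by simp, by simp⟩, by simp [syllableWord]⟩
  | mul_left z hz h _ ih => simpa using step z hz 1 one_ne_zero h ih
  | inv_mul_cancel z hz h _ ih => simpa using step z hz (-1) (by norm_num) h ih

theorem exists_list_zpow {S : Set G} {x : G} (hx : x ∈ S) (a : ℤ) :
    ∃ l : List G, (∀ s ∈ l, s ∈ S ∨ s⁻¹ ∈ S) ∧ l.prod = x ^ a ∧ l.length = a.natAbs := by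
  obtain ⟨n, rfl | rfl⟩ := a.eq_nat_or_neg
  · refine ⟨List.replicate n x, fun s hs => ?_, by simp, by simp⟩
    rw [List.eq_of_mem_replicate hs]
    exact Or.inl hx
  · refine ⟨List.replicate n x⁻¹, fun s hs => ?_, by simp, by simp⟩
    rw [List.eq_of_mem_replicate hs, inv_inv]
    exact Or.inr hx

theorem exists_list_syllableWord (x y : G) (l : List (ℤ × ℤ)) (c : ℤ) :
    ∃ w : List G, (∀ s ∈ w, s ∈ ({x, y} : Set G) ∨ s⁻¹ ∈ ({x, y} : Set G)) ∧
      w.prod = syllableWord x y l c ∧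
      w.length = (l.map fun s => s.1.natAbs + s.2.natAbs).sum + c.natAbs := by
  induction l with
  | nil => simpa [syllableWord] using exists_list_zpow (S := {x, y}) (by simp) c
  | cons s l ih =>
    obtain ⟨w, hw, hw', hw''⟩ := ih
    obtain ⟨w₁, h₁, h₁', h₁''⟩ := exists_list_zpow (S := {x, y}) (x := x) (by simp) s.1
    obtain ⟨w₂, h₂, h₂', h₂''⟩ := exists_list_zpow (S := {x, y}) (x := y) (by simp) s.2
    refine ⟨w₁ ++ w₂ ++ w, fun t ht => ?_, by simp [syllableWord, mul_assoc, *], ?_⟩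
    · simp only [List.mem_append] at ht
      rcases ht with (ht | ht) | ht
      exacts [h₁ t ht, h₂ t ht, hw t ht]
    · simp only [List.length_append, List.map_cons, List.sum_cons, *]
      ring

theorem wordLength_syllableWord_le (x y : G) (l : List (ℤ × ℤ)) (c : ℤ) :
    wordLength {x, y} (syllableWord x y l c) ≤
      (l.map fun s => s.1.natAbs + s.2.natAbs).sum + c.natAbs :=
  Nat.sInf_le (exists_list_syllableWord x y l c)

variable {Γ : Type u} [MetricSpace Γ] [MulAction G Γ] [IsIsometricSMul G Γ]

theorem dist_list_prod_smul_le {S : Set G} {A : ℝ} {x : Γ} (hA : ∀ s ∈ S, dist x (s • x) ≤ A)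
    {l : List G} (hl : ∀ s ∈ l, s ∈ S ∨ s⁻¹ ∈ S) : dist x (l.prod • x) ≤ A * l.length := by
  induction l with
  | nil => simp
  | cons s l ih =>
    have h1 := ih fun t ht => hl t (List.mem_cons_of_mem _ ht)
    have h2 : dist x (s • x) ≤ A := by
      rcases hl s List.mem_cons_self with h | h
      · exact hA s h
      · have := hA _ h
        rwa [← dist_smul s, smul_inv_smul, dist_comm] at this
    have h3 := dist_triangle x (s • x) ((s * l.prod) • x)
    rw [mul_smul, dist_smul] at h3
    rw [List.prod_cons, mul_smul, List.length_cons]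
    push_cast
    linarith

/-- A linear lower bound on the displacement by reduced words implies that two elements generate
a free group, quasi-isometrically embedded by the orbit maps. -/
theorem free_and_quasiIsometric_of_displacement {x y : G} {p : Γ} {τ T : ℝ} (hτ : 0 < τ)
    (hT : 0 < T) (h : ∀ (l : List (ℤ × ℤ)) (c : ℤ), IsReducedSyllables l →
      (l.map fun s => |(s.1 : ℝ)| * τ + |(s.2 : ℝ)| * T).sum + |(c : ℝ)| * τ ≤
        dist p (syllableWord x y l c • p)) :
    Nonempty (Subgroup.closure {x, y} ≃* FreeGroup (Fin 2)) ∧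
      ∀ z : Γ, IsQuasiIsometricOrbit {x, y} z := by
  have hnn : ∀ l : List (ℤ × ℤ), 0 ≤ (l.map fun s => |(s.1 : ℝ)| * τ + |(s.2 : ℝ)| * T).sum := by
    intro l
    refine List.sum_nonneg fun r hr => ?_
    obtain ⟨s, -, rfl⟩ := List.mem_map.mp hr
    positivity
  constructor
  · set φ : FreeGroup (Fin 2) →* G := FreeGroup.lift ![x, y] with hφ
    have hrange : φ.range = Subgroup.closure {x, y} := by
      rw [hφ, FreeGroup.range_lift_eq_closure]
      simp [Matrix.range_cons, Set.pair_comm]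
    have hinj : Function.Injective φ := by
      rw [injective_iff_map_eq_one]
      intro w hw
      have hw' : w ∈ Subgroup.closure {FreeGroup.of (0 : Fin 2), FreeGroup.of 1} := by
        have h1 := FreeGroup.closure_range_of (Fin 2)
        have h2 : Set.range (FreeGroup.of : Fin 2 → FreeGroup (Fin 2)) =
            {FreeGroup.of 0, FreeGroup.of 1} := by
          ext v
          simp [Fin.exists_fin_two, eq_comm]
        rw [← h2, h1]
        trivial
      -- Only existence of a reduced form in the free group is needed: a kernel element has zero
      -- displacement, so its form is empty.
      obtain ⟨l, c, hl, rfl⟩ := exists_syllableWord hw'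
      rw [map_syllableWord] at hw
      have h1 := h l c hl
      simp only [hφ, FreeGroup.lift_apply_of, Matrix.cons_val_zero, Matrix.cons_val_one] at hw
      rw [hw, one_smul, dist_self] at h1
      have h2 := hnn l
      rcases l with - | ⟨s, l⟩
      · have : |(c : ℝ)| * τ ≤ 0 := by simpa using h1
        have : c = 0 := by
          by_contra hc
          have : 0 < |(c : ℝ)| * τ := by positivity
          linarith
        simp [syllableWord, this]
      · have hs : s.2 ≠ 0 := hl.1 s List.mem_cons_self
        have h3 := hnn l
        have h4 : 0 < |(s.2 : ℝ)| * T := by positivity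
        have h5 : 0 ≤ |(s.1 : ℝ)| * τ := by positivity
        have h6 : 0 ≤ |(c : ℝ)| * τ := by positivity
        simp only [List.map_cons, List.sum_cons] at h1
        linarith
    exact ⟨((MonoidHom.ofInjective hinj).trans (MulEquiv.subgroupCongr hrange)).symm⟩
  · intro z
    set κ := min τ T with hκ
    have hκ0 : 0 < κ := lt_min hτ hT
    set A := max 1 (max (1 / κ) (max (dist z (x • z)) (dist z (y • z)))) with hA
    have hA1 : 1 ≤ A := le_max_left _ _
    have hAκ : 1 / κ ≤ A := (le_max_left _ _).trans (le_max_right _ _)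
    have hAd : ∀ s ∈ ({x, y} : Set G), dist z (s • z) ≤ A := by
      rintro s (rfl | rfl)
      · exact (le_max_left _ _).trans ((le_max_right _ _).trans
          ((le_max_right _ _)))
      · exact (le_max_right _ _).trans ((le_max_right _ _).trans
          ((le_max_right _ _)))
    refine ⟨A, 2 * dist z p, hA1, by positivity, fun u hu v hv => ?_⟩
    obtain ⟨l, c, hl, hw⟩ := exists_syllableWord (mul_mem (inv_mem hu) hv)
    have hd : dist (u • z) (v • z) = dist z ((u⁻¹ * v) • z) := by
      rw [← dist_smul u z, mul_smul, smul_inv_smul]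
    rw [hd]
    constructor
    · have h1 := wordLength_syllableWord_le x y l c
      have h2 := h l c hl
      rw [hw] at h1 h2
      have h3 : κ * ((l.map fun s => s.1.natAbs + s.2.natAbs).sum + c.natAbs : ℕ) ≤
          (l.map fun s => |(s.1 : ℝ)| * τ + |(s.2 : ℝ)| * T).sum + |(c : ℝ)| * τ := by
        have hκτ : κ ≤ τ := min_le_left _ _
        have hκT : κ ≤ T := min_le_right _ _
        have hc : κ * |(c : ℝ)| ≤ |(c : ℝ)| * τ := by
          rw [mul_comm]
          gcongr
        push_cast [Nat.cast_natAbs, Int.cast_abs]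
        rw [mul_add]
        refine add_le_add ?_ hc
        clear h1 h2 hc hw hl
        induction l with
        | nil => simp
        | cons s l ih =>
          simp only [List.map_cons, List.sum_cons]
          push_cast [Nat.cast_natAbs, Int.cast_abs] at ih ⊢
          have h4 : κ * |(s.1 : ℝ)| ≤ |(s.1 : ℝ)| * τ := by
            rw [mul_comm]
            gcongr
          have h5 : κ * |(s.2 : ℝ)| ≤ |(s.2 : ℝ)| * T := by
            rw [mul_comm]
            gcongr
          linarith
      have h4 : (wordLength {x, y} (u⁻¹ * v) : ℝ) ≤
          ((l.map fun s => s.1.natAbs + s.2.natAbs).sum + c.natAbs : ℕ) := by exact_mod_cast h1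
      have h5 : (wordLength {x, y} (u⁻¹ * v) : ℝ) / A ≤ κ * wordLength {x, y} (u⁻¹ * v) := by
        rw [div_le_iff₀ (by linarith)]
        have h6 : 1 ≤ κ * A := by
          rw [div_le_iff₀ hκ0] at hAκ
          linarith
        have h7 : (0 : ℝ) ≤ wordLength {x, y} (u⁻¹ * v) := by positivity
        nlinarith
      have h6 : κ * wordLength {x, y} (u⁻¹ * v) ≤
          κ * ((l.map fun s => s.1.natAbs + s.2.natAbs).sum + c.natAbs : ℕ) := by gcongr
      have h7 := dist_triangle4 p z ((u⁻¹ * v) • z) ((u⁻¹ * v) • p)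
      rw [dist_smul, dist_comm p z] at h7
      linarith
    · have hne : {n : ℕ | ∃ l : List G, (∀ s ∈ l, s ∈ ({x, y} : Set G) ∨ s⁻¹ ∈ ({x, y} : Set G)) ∧
          l.prod = u⁻¹ * v ∧ l.length = n}.Nonempty := by
        obtain ⟨w, hw₁, hw₂, -⟩ := exists_list_syllableWord x y l c
        exact ⟨_, w, hw₁, hw₂.trans hw, rfl⟩
      obtain ⟨w, hw₁, hw₂, hw₃⟩ := Nat.sInf_mem hne
      have h1 := dist_list_prod_smul_le hAd hw₁
      rw [hw₂, hw₃] at h1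
      have h2 : 0 ≤ 2 * dist z p := by positivity
      exact h1.trans (by rw [wordLength]; linarith)

end Words

/-! ### Local-to-global argument for broken orbit paths. -/

section Chain

variable {Γ : Type u} [MetricSpace Γ] {δ : ℝ} {G : Type v} [Group G] [MulAction G Γ]
  [IsIsometricSMul G Γ]

theorem dist_inv_smul_left (a : G) (x y : Γ) : dist (a⁻¹ • x) y = dist x (a • y) := by
  rw [← dist_smul a, smul_inv_smul]

/-- A local-to-global principle: if the broken orbit path of a word has long edges and small
Gromov products at its corners, then the displacement by the word is additive up to an error. -/
theorem IsDeltaHyperbolic.le_dist_syllableWord (h : IsDeltaHyperbolic Γ δ) {g f : G} {p : Γ}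
    {E : ℝ} {n : ℕ}
    (hedge : ∀ a b : ℤ, b ≠ 0 → 2 * E + 4 * δ < dist p ((g ^ a * (f ^ n) ^ b) • p))
    (hcorner : ∀ a b a' b' : ℤ, b ≠ 0 → a' ≠ 0 → b' ≠ 0 →
      dist ((g ^ a * (f ^ n) ^ b)⁻¹ • p) p + dist p ((g ^ a' * (f ^ n) ^ b') • p) ≤
        dist ((g ^ a * (f ^ n) ^ b)⁻¹ • p) ((g ^ a' * (f ^ n) ^ b') • p) + 2 * E)
    (hlast : ∀ a b c : ℤ, b ≠ 0 →
      dist ((g ^ a * (f ^ n) ^ b)⁻¹ • p) p + dist p (g ^ c • p) ≤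
        dist ((g ^ a * (f ^ n) ^ b)⁻¹ • p) (g ^ c • p) + 2 * E)
    (l : List (ℤ × ℤ)) (c : ℤ) (hl : IsReducedSyllables l) :
    (l.map fun s => dist p ((g ^ s.1 * (f ^ n) ^ s.2) • p) - (2 * E + 4 * δ)).sum +
      dist p (g ^ c • p) ≤ dist p (syllableWord g (f ^ n) l c • p) := by
  have hδ : 0 ≤ δ := by
    have : Nonempty Γ := ⟨p⟩
    exact h.nonneg
  have key : ∀ l : List (ℤ × ℤ), (∀ s ∈ l, s.2 ≠ 0) → (∀ s ∈ l, s.1 ≠ 0) →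
      ∀ a b : ℤ, b ≠ 0 →
      dist p ((g ^ a * (f ^ n) ^ b) • p) + dist p (syllableWord g (f ^ n) l c • p) ≤
        dist p ((g ^ a * (f ^ n) ^ b) • syllableWord g (f ^ n) l c • p) + (2 * E + 4 * δ) := by
    intro l
    induction l with
    | nil =>
      intro _ _ a b hb
      have := hlast a b c hb
      rw [dist_inv_smul_left, dist_inv_smul_left] at this
      simp only [syllableWord]
      linarith
    | cons s l ih =>
      intro h2 h1 a b hb
      have hs1 := h1 s List.mem_cons_self
      have hs2 := h2 s List.mem_cons_self
      have e1 := ih (fun t ht => h2 t (List.mem_cons_of_mem _ ht))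
        (fun t ht => h1 t (List.mem_cons_of_mem _ ht)) s.1 s.2 hs2
      have e2 := hcorner a b s.1 s.2 hb hs1 hs2
      have e3 := hedge s.1 s.2 hs2
      rw [syllableWord, mul_smul _ (syllableWord g (f ^ n) l c)]
      set k := g ^ a * (f ^ n) ^ b
      set k' := g ^ s.1 * (f ^ n) ^ s.2
      set w := syllableWord g (f ^ n) l c • p
      -- The corner at `p` and the inductive estimate at `k' • p` make the left sum large. As the
      -- edge from `p` to `k' • p` is long, the first alternative is impossible; the second extends
      -- the estimate by one block.
      have e4 := h.four_point (k⁻¹ • p) p (k' • p) (k' • w)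
      rw [dist_smul] at e4
      simp only [dist_inv_smul_left] at e2 e4
      rcases max_cases (dist p (k • p) + dist p w)
        (dist p (k • k' • w) + dist p (k' • p)) with ⟨e5, -⟩ | ⟨e5, -⟩ <;> rw [e5] at e4 <;>
        linarith
  cases l with
  | nil => simp [syllableWord]
  | cons s l =>
    have h1 : ∀ l : List (ℤ × ℤ), (∀ s ∈ l, s.2 ≠ 0) → (∀ s ∈ l, s.1 ≠ 0) →
        (l.map fun s => dist p ((g ^ s.1 * (f ^ n) ^ s.2) • p) - (2 * E + 4 * δ)).sum +
          dist p (g ^ c • p) ≤ dist p (syllableWord g (f ^ n) l c • p) := by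
      intro l
      induction l with
      | nil => simp [syllableWord]
      | cons s l ih =>
        intro h2 h1
        have e1 := ih (fun t ht => h2 t (List.mem_cons_of_mem _ ht))
          (fun t ht => h1 t (List.mem_cons_of_mem _ ht))
        have e2 := key l (fun t ht => h2 t (List.mem_cons_of_mem _ ht))
          (fun t ht => h1 t (List.mem_cons_of_mem _ ht)) s.1 s.2 (h2 s List.mem_cons_self)
        rw [List.map_cons, List.sum_cons, syllableWord, mul_smul _ (syllableWord g (f ^ n) l c)]
        linarith
    have e1 := h1 l hl.tail.1 hl.2
    have e2 := key l hl.tail.1 hl.2 s.1 s.2 (hl.1 s List.mem_cons_self)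
    rw [List.map_cons, List.sum_cons, syllableWord, mul_smul _ (syllableWord g (f ^ n) l c)]
    linarith

/-- Projection is equivariant under a coarse translation, at the cost of its error at two points of
the line. -/
theorem IsProj.smul {f : G} {α : ℝ → Γ} {T c d : ℝ}
    (hf : ∀ (i : ℤ) (t : ℝ), dist (f ^ i • α t) (α (t + i * T)) ≤ d) {x : Γ} {t : ℝ}
    (hx : IsProj α c x t) (i : ℤ) : IsProj α (c + 2 * d) (f ^ i • x) (t + i * T) := by
  intro s
  have e1 := hf i t
  have e2 := hf i (s - i * T)
  have e3 := hx (s - i * T)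
  have e4 := dist_triangle (f ^ i • x) (f ^ i • α t) (α (t + i * T))
  have e5 := dist_triangle (f ^ i • x) (α s) (f ^ i • α (s - i * T))
  rw [sub_add_cancel, dist_comm] at e2
  rw [dist_smul] at e4 e5
  rw [show s - (t + i * T) = s - i * T - t by ring]
  linarith

/-- If all nontrivial powers of `g` move `α` so that the image has a bounded projection to `α`, and
if the line `β` preserved by `g` has a bounded projection to `α`, then `g` and a large power of the
translation `f` along `α` generate a free group. -/
theorem IsDeltaHyperbolic.free_of_bounded_projections (h : IsDeltaHyperbolic Γ δ) [Nonempty Γ]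
    {f g : G} {α β : ℝ → Γ} (hα : Isometry α) {T D₁ D₂ : ℝ} (hT : 0 < T)
    (hg0 : 0 < translationLength Γ g)
    (hf : ∀ (i : ℤ) (t : ℝ), dist (f ^ i • α t) (α (t + i * T)) ≤ 72 * δ)
    (hg : ∀ (i : ℤ) (t : ℝ), ∃ t', dist (g ^ i • β t) (β t') ≤ 72 * δ)
    (hD₁ : ∀ s₁ s₂ t₁ t₂, IsProj α (8 * δ) (β s₁) t₁ → IsProj α (8 * δ) (β s₂) t₂ →
      |t₁ - t₂| ≤ D₁)
    (hD₂ : ∀ a : ℤ, a ≠ 0 → ∀ s₁ s₂ t₁ t₂, IsProj α (8 * δ) (g ^ a • α s₁) t₁ →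
      IsProj α (8 * δ) (g ^ a • α s₂) t₂ → |t₁ - t₂| ≤ D₂)
    {n : ℕ} (hn : 4 * (2 * T + 100 * δ + D₁ + D₂) + 392 * δ ≤ (n - 1) * T) :
    Nonempty (Subgroup.closure {g, f ^ n} ≃* FreeGroup (Fin 2)) ∧
      ∀ x : Γ, IsQuasiIsometricOrbit {g, f ^ n} x := by
  have hδ := h.nonneg
  -- The distance between the lines need not be attained; an error of `T` is harmless.
  obtain ⟨t₀, s₀, hmin⟩ : ∃ t₀ s₀, ∀ t s, dist (α t₀) (β s₀) ≤ dist (α t) (β s) + T := by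
    have hbdd : BddBelow (Set.range fun q : ℝ × ℝ => dist (α q.1) (β q.2)) :=
      ⟨0, by rintro _ ⟨q, rfl⟩; exact dist_nonneg⟩
    obtain ⟨q, hq⟩ := exists_lt_of_ciInf_lt
      (lt_add_of_pos_right (⨅ q : ℝ × ℝ, dist (α q.1) (β q.2)) hT)
    exact ⟨q.1, q.2, fun t s => hq.le.trans (by linarith [ciInf_le hbdd (t, s)])⟩
  set p := α t₀ with hp
  set C₂ := 2 * T + 100 * δ + D₁ with hC₂
  obtain ⟨r₀, hr₀, -⟩ := h.exists_isProj hα (β s₀)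
  have hD₁0 : 0 ≤ D₁ := (abs_nonneg _).trans (hD₁ _ _ _ _ hr₀ hr₀)
  have hr₀' : |r₀ - t₀| ≤ T + 8 * δ := by
    have e1 := hr₀ t₀
    have e2 := hmin r₀ s₀
    rw [dist_comm (α t₀), dist_comm (α r₀)] at e2
    rw [abs_sub_comm]
    linarith
  -- The point `g ^ a • p` is almost as close to `β` as the two lines are to each other, so it
  -- projects near the projection of a point of `β`.
  have hproj : ∀ (a : ℤ) (t : ℝ), IsProj α (8 * δ) (g ^ a • p) t → |t - t₀| ≤ C₂ := by
    intro a t ht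
    obtain ⟨s, hs⟩ := hg a s₀
    obtain ⟨r, hr, -⟩ := h.exists_isProj hα (β s)
    have e1 := hD₁ _ _ _ _ hr hr₀
    have e2 := hmin r s
    have e3 := dist_triangle (g ^ a • p) (g ^ a • β s₀) (β s)
    rw [dist_smul] at e3
    have e4 := dist_nonneg (x := g ^ a • p) (y := α t)
    have e5 : |t - t₀| ≤ |t - r| + |r - r₀| + |r₀ - t₀| := by
      have := abs_sub_le t r t₀
      have := abs_sub_le r r₀ t₀
      linarith
    rw [dist_comm (α r)] at e2
    rcases h.dist_of_isProj hα ht hr with e6 | e6 <;> linarith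
  have hproj' : ∀ a : ℤ, a ≠ 0 → ∀ s t : ℝ, IsProj α (8 * δ) (g ^ a • α s) t →
      |t - t₀| ≤ C₂ + D₂ := by
    intro a ha s t ht
    obtain ⟨r, hr, -⟩ := h.exists_isProj hα (g ^ a • p)
    have := abs_sub_le t r t₀
    have := hproj a r hr
    have := hD₂ a ha _ _ _ _ ht hr
    linarith
  have hD₂0 : 0 ≤ D₂ := by
    obtain ⟨r, hr, -⟩ := h.exists_isProj hα (g ^ (1 : ℤ) • p)
    exact (abs_nonneg _).trans (hD₂ 1 one_ne_zero _ _ _ _ hr hr)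
  have habs : ∀ b : ℤ, b ≠ 0 → (1 : ℝ) ≤ |(b : ℝ)| := fun b hb => by
    exact_mod_cast Int.one_le_abs hb
  have hnT : 4 * (C₂ + D₂) + 392 * δ + T ≤ n * T := by linarith
  have hnb : ∀ b : ℤ, b ≠ 0 → 4 * (C₂ + D₂) + 392 * δ + |(b : ℝ)| * T ≤ |(b : ℝ)| * (n * T) := by
    intro b hb
    have h1 := habs b hb
    have h2 : 0 ≤ 4 * (C₂ + D₂) + 392 * δ := by positivity
    nlinarith
  have hpow : ∀ b : ℤ, (f ^ n) ^ b = f ^ ((n : ℤ) * b) := fun b => by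
    rw [zpow_mul, zpow_natCast]
  have hcast : ∀ b : ℤ, |(((n : ℤ) * b : ℤ) : ℝ) * T| = |(b : ℝ)| * (n * T) := fun b => by
    push_cast
    rw [abs_mul, abs_mul, Nat.abs_cast, abs_of_pos hT]
    ring
  have hlen : ∀ a b : ℤ, dist p (g ^ a • p) + |(b : ℝ)| * (n * T) - 2 * C₂ - 80 * δ ≤
      dist p ((g ^ a * (f ^ n) ^ b) • p) := by
    intro a b
    obtain ⟨t, ht, -⟩ := h.exists_isProj hα (g ^ (-a) • p)
    have e1 := hproj _ _ ht
    have e2 := ht (t₀ + ((n : ℤ) * b : ℤ) * T)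
    have e3 := hf ((n : ℤ) * b) t₀
    have e4 := dist_triangle (g ^ (-a) • p) ((f ^ n) ^ b • p) (α (t₀ + ((n : ℤ) * b : ℤ) * T))
    rw [hpow b] at e4 ⊢
    have e5 := dist_triangle (g ^ (-a) • p) (α t) p
    rw [hα.dist_real] at e5
    have e6 := abs_sub_abs_le_abs_sub (((n : ℤ) * b : ℤ) * T : ℝ) (t - t₀)
    rw [hcast b, show (((n : ℤ) * b : ℤ) * T : ℝ) - (t - t₀) =
      t₀ + ((n : ℤ) * b : ℤ) * T - t by ring] at e6
    rw [mul_smul]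
    simp only [zpow_neg, dist_inv_smul_left] at *
    linarith
  have hcorner : ∀ (a b : ℤ) (y : Γ) (r : ℝ), b ≠ 0 → IsProj α (8 * δ) y r →
      |r - t₀| ≤ C₂ + D₂ → dist ((g ^ a * (f ^ n) ^ b)⁻¹ • p) p + dist p y ≤
        dist ((g ^ a * (f ^ n) ^ b)⁻¹ • p) y + (2 * (C₂ + D₂) + 164 * δ) := by
    intro a b y r hb hr hr'
    obtain ⟨t, ht, -⟩ := h.exists_isProj hα (g ^ (-a) • p)
    have e1 := hproj _ _ ht
    have e2 := ht.smul hf ((n : ℤ) * -b)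
    have e3 : (g ^ a * (f ^ n) ^ b)⁻¹ • p = f ^ ((n : ℤ) * -b) • g ^ (-a) • p := by
      rw [mul_inv_rev, mul_smul, ← zpow_neg, ← zpow_neg, hpow]
    rw [e3]
    set x := f ^ ((n : ℤ) * -b) • g ^ (-a) • p
    set t' := t + (((n : ℤ) * -b : ℤ) : ℝ) * T with ht'
    have e4 := hnb b hb
    have e5 := abs_sub_abs_le_abs_sub ((((n : ℤ) * -b : ℤ) : ℝ) * T) (t₀ - t)
    rw [hcast, show (((n : ℤ) * -b : ℤ) : ℝ) * T - (t₀ - t) = t' - t₀ by rw [ht']; ring,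
      abs_sub_comm t₀, Int.cast_neg, abs_neg] at e5
    have e6 := abs_sub_le t' r t₀
    have e7 := dist_triangle x (α t') p
    have e8 := dist_triangle y (α r) p
    have e9 : 0 < |(b : ℝ)| * T := by positivity
    rw [hα.dist_real] at e7 e8
    rw [dist_comm p y]
    rcases h.dist_of_isProj hα e2 hr with e10 | e10 <;> linarith
  refine free_and_quasiIsometric_of_displacement (p := p) hg0 hT fun l c hl => ?_
  -- Here `2 * E` is the corner error `2 * (C₂ + D₂) + 164 * δ` plus `2 * 72 * δ` for replacing the
  -- orbit point of `f` by a point of `α`.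
  refine le_trans ?_ (h.le_dist_syllableWord (E := (C₂ + D₂) + 154 * δ) ?_ ?_ ?_ l c hl)
  · refine add_le_add (List.sum_le_sum fun s hs => ?_) (abs_mul_translationLength_le_dist g p c)
    have e1 := hlen s.1 s.2
    have e2 := hnb s.2 (hl.1 s hs)
    have e3 := abs_mul_translationLength_le_dist g p s.1
    linarith
  · intro a b hb
    have e1 := hlen a b
    have e2 := hnb b hb
    have e3 := dist_nonneg (x := p) (y := g ^ a • p)
    have e9 : 0 < |(b : ℝ)| * T := by positivity
    linarith
  · intro a b a' b' hb ha' hb'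
    obtain ⟨r, hr, -⟩ := h.exists_isProj hα (g ^ a' • α (t₀ + ((n : ℤ) * b' : ℤ) * T))
    have e1 := hcorner a b _ r hb hr (hproj' a' ha' _ _ hr)
    have e2 := hf ((n : ℤ) * b') t₀
    rw [← dist_smul (g ^ a'), ← mul_smul, ← hpow, ← hp] at e2
    have e3 := dist_triangle p (g ^ a' • α (t₀ + ((n : ℤ) * b' : ℤ) * T))
      ((g ^ a' * (f ^ n) ^ b') • p)
    have e4 := dist_triangle ((g ^ a * (f ^ n) ^ b)⁻¹ • p) ((g ^ a' * (f ^ n) ^ b') • p)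
      (g ^ a' • α (t₀ + ((n : ℤ) * b' : ℤ) * T))
    rw [dist_comm (g ^ a' • α (t₀ + ((n : ℤ) * b' : ℤ) * T))] at e3
    linarith
  · intro a b c hb
    obtain ⟨r, hr, -⟩ := h.exists_isProj hα (g ^ c • p)
    have e1 := hcorner a b _ r hb hr ((hproj c r hr).trans (by linarith))
    linarith

end Chain

/-! ### Bounded projections of translated axes, and the choice of `N`. -/

section Main

variable {Γ : Type u} [MetricSpace Γ] {δ : ℝ} {G : Type v} [Group G] [MulAction G Γ]
  [IsIsometricSMul G Γ] {X : MetricGraph Γ} {K L : ℝ → ℝ}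

/-- If `k` does not normalise a nontrivial power of `f`, then the image under `k` of the axis of
`f` has a bounded projection to the axis. -/
theorem IsDeltaHyperbolic.abs_sub_le_of_not_conj (h : IsDeltaHyperbolic Γ δ)
    (hac : IsAcylindrical X G K L) {f : G} {α : ℝ → Γ} (hα : Isometry α) {T : ℝ} (hT : 0 < T)
    (hf : ∀ (i : ℤ) (t : ℝ), dist (f ^ i • α t) (α (t + i * T)) ≤ 72 * δ)
    {m : ℕ} (hm : 333 ^ 2 * K (20 * δ) < m + 1) {k : G}
    (hk : ¬∃ r : ℤ, r ≠ 0 ∧ ∃ η : ℤ, (η = 1 ∨ η = -1) ∧ k * f ^ r * k⁻¹ = f ^ (η * r))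
    {s₁ s₂ t₁ t₂ : ℝ} (h₁ : IsProj α (8 * δ) (k • α s₁) t₁)
    (h₂ : IsProj α (8 * δ) (k • α s₂) t₂) :
    |t₁ - t₂| ≤ m * T + L (20 * δ) + 360 * δ + 5 := by
  wlog hle : t₁ ≤ t₂ generalizing s₁ s₂ t₁ t₂
  · rw [abs_sub_comm]
    exact this h₂ h₁ (le_of_not_ge hle)
  have : Nonempty Γ := ⟨α 0⟩
  have hδ := h.nonneg
  have hL := (hac (20 * δ) (by linarith)).2.1
  have hmT : 0 ≤ m * T := by positivity
  by_contra! hlt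
  rw [abs_of_nonpos (by linarith)] at hlt
  have hkα := isometry_smul_line k hα
  obtain ⟨r₁, hr₁⟩ := h.exists_near_of_isProj hα hkα (by linarith) h₁ h₂
    (u := t₁ + 10 * δ + 1 / 4) (by linarith) (by linarith)
  obtain ⟨r₂, hr₂⟩ := h.exists_near_of_isProj hα hkα (by linarith) h₁ h₂
    (u := t₂ - 10 * δ - 1 / 4) (by linarith) (by linarith)
  have e1 := dist_triangle4 (α (t₁ + 10 * δ + 1 / 4)) (k • α r₁) (k • α r₂)
    (α (t₂ - 10 * δ - 1 / 4))
  rw [dist_comm] at hr₁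
  rw [hα.dist_real, dist_smul, hα.dist_real, abs_of_nonpos (by linarith),
    dist_comm (α (t₁ + 10 * δ + 1 / 4))] at e1
  rw [dist_comm] at hr₂
  apply hk
  rcases abs_cases (r₁ - r₂) with ⟨e2, -⟩ | ⟨e2, -⟩ <;> rw [e2] at e1
  · exact h.exists_conj_of_long_overlap hac hα hT hf hm hr₂ hr₁ (by linarith)
  · exact h.exists_conj_of_long_overlap hac hα hT hf hm hr₁ hr₂ (by linarith)

end Main

theorem proposition7 :
    ∃ N : ℝ → ℝ → ℝ → ℝ → ℕ, (∀ δ k l k', 0 < N δ k l k') ∧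
      ∀ (δ : ℝ), 0 ≤ δ →
      ∀ (Γ : Type u) [MetricSpace Γ] [Nonempty Γ] (X : MetricGraph Γ),
      IsDeltaHyperbolic Γ δ →
      ∀ (G : Type v) [Group G] [MulAction G Γ] [IsIsometricSMul G Γ] (K L : ℝ → ℝ),
      IsAcylindrical X G K L →
      ∀ (f g : G) (α β : ℝ → Γ),
      IsHyperbolicIsometry Γ f → IsHyperbolicIsometry Γ g →
      IsQuasiAxis f α → IsQuasiAxis g β →
      (∀ s t : ℤ, s ≠ 0 → t ≠ 0 → (f ^ s)⁻¹ * (g ^ t)⁻¹ * f ^ s * g ^ t ≠ 1) →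
      translationLength Γ g ≤ translationLength Γ f →
      Metric.ediam (overlap (10 * δ) (Set.range α) (Set.range β)) ≤
        ENNReal.ofReal (2 * translationLength Γ f) →
      ∀ n : ℕ, N δ (K (20 * δ)) (L (20 * δ)) (K (200 * δ)) ≤ n →
        Nonempty (Subgroup.closure {g, f ^ n} ≃* FreeGroup (Fin 2)) ∧
        ∀ x : Γ, IsQuasiIsometricOrbit {g, f ^ n} x := by
  -- With the values of `D₁` and `D₂` below, the required bound is `16T + 4mT + 2312δ + 4L + 20 ≤ (n
  -- - 1) * T`. Use `δ ≤ mT` and `1 ≤ θT`, where `θ` is the value of the conditional; the final `+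
  -- 1` accounts for `n - 1`.
  refine ⟨fun δ k l _ => ⌈16 + 2316 * (⌊333 ^ 2 * k⌋₊ : ℝ) +
    (4 * l + 20) * if δ = 0 then 1 else (⌊333 ^ 2 * k⌋₊ : ℝ) / δ⌉₊ + 1,
    fun _ _ _ _ => Nat.succ_pos _, ?_⟩
  intro δ hδ Γ _ _ X h G _ _ _ K L hac f g α β hfh hgh hfα hgβ hcomm _ hov n hn
  have hβ := hgβ.1
  have hT := hfh.translationLength_pos
  have hfpow : ∀ i : ℕ, f ^ i = 1 → i = 0 := by
    intro i hi
    have h1 := translationLength_le_dist f (Classical.arbitrary Γ) i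
    rw [hi, one_smul, dist_self] at h1
    by_contra hne
    have : (0 : ℝ) < i := by exact_mod_cast Nat.pos_of_ne_zero hne
    have := mul_pos this hT
    linarith
  obtain ⟨α', hα', hrange, hf⟩ := h.exists_translation_axis hfh hfα
  obtain ⟨β', -, hrange', hg⟩ := h.exists_translation_axis hgh hgβ
  obtain ⟨hK, hL, -⟩ := hac (20 * δ) (by linarith)
  rw [← hrange] at hov
  set T := translationLength Γ f
  set m := ⌊333 ^ 2 * K (20 * δ)⌋₊ with hm
  have hmK : 333 ^ 2 * K (20 * δ) < m + 1 := Nat.lt_floor_add_one _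
  have hδT : δ ≤ m * T := h.le_mul_translation hac hα' hT hf hfpow (by linarith)
  set θ : ℝ := if δ = 0 then 1 else (m : ℝ) / δ with hθ
  have hθT : 1 ≤ θ * T := by
    by_cases h0 : δ = 0
    · subst h0
      obtain ⟨s, hs⟩ := exists_notMem_range_of_overlap hβ (by simp) (by linarith) hov
      rw [hθ, if_pos rfl, one_mul]
      refine h.one_le_translation X hα' (f := f) hT (fun t => ?_) hs
      have := hf 1 t
      rw [mul_zero] at this
      simpa using dist_le_zero.mp this
    · have hpos := hδ.lt_of_ne' h0
      rw [hθ, if_neg h0, div_mul_eq_mul_div, one_le_div hpos]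
      exact hδT
  refine h.free_of_bounded_projections hα' (β := β) hT hgh.translationLength_pos hf
    (D₁ := 2 * T + 20 * δ) (D₂ := m * T + L (20 * δ) + 360 * δ + 5) ?_ ?_ ?_ ?_
  · intro i t
    obtain ⟨t', ht'⟩ : β t ∈ Set.range β' := hrange' ▸ ⟨t, rfl⟩
    obtain ⟨r, hr⟩ : β' (t' + i * translationLength Γ g) ∈ Set.range β := hrange' ▸ ⟨_, rfl⟩
    refine ⟨r, ?_⟩
    rw [hr, ← ht']
    exact hg i t'
  · intro s₁ s₂ t₁ t₂ h₁ h₂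
    exact h.abs_sub_le_of_overlap hα' hβ (by linarith) (by linarith) hov h₁ h₂
  · intro a ha s₁ s₂ t₁ t₂ h₁ h₂
    refine h.abs_sub_le_of_not_conj hac hα' hT hf hmK ?_ h₁ h₂
    rintro ⟨r, hr, η, hη, hconj⟩
    -- Now `g ^ (2 * a)` and `f ^ r` commute, contrary to the commutator hypothesis.
    have h1 := conj_zpow_eq hη hconj
    refine hcomm r (a * 2) hr (by omega) ?_
    rw [zpow_mul, mul_assoc, zpow_ofNat, ← h1]
    group
  · have h1 : (16 + 2316 * (m : ℝ) + (4 * L (20 * δ) + 20) * θ) ≤ (n : ℝ) - 1 := by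
      have h2 := Nat.le_ceil (16 + 2316 * (m : ℝ) + (4 * L (20 * δ) + 20) * θ)
      have h3 : ((⌈16 + 2316 * (m : ℝ) + (4 * L (20 * δ) + 20) * θ⌉₊ + 1 : ℕ) : ℝ) ≤ n := by
        exact Nat.cast_le.mpr hn
      push_cast at h3
      linarith
    have h4 : (16 + 2316 * (m : ℝ) + (4 * L (20 * δ) + 20) * θ) * T ≤ (n - 1) * T := by gcongr
    have h5 : (4 * L (20 * δ) + 20) * 1 ≤ (4 * L (20 * δ) + 20) * (θ * T) := by gcongr
    linarith
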